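/- In the abstract tile assembly model (aTAM), a tile system $\Gamma=(T,\sigma,\tau)$ consists of a finite set $T$ of non-rotatable unit square tile types with a glue on each edge (each glue having a non-negative integer strength), a seed assembly $\sigma$ and a positive integer temperature $\tau$. Assembly starts from $\sigma$ and proceeds by attaching one tile at a time so that each new assembly is $\tau$-stable, i.e. every cut of its bond graph has weight at least $\tau$. An assembly is terminal if it is producible in this way and no further tile can attach. A concentration distribution is a function $P:T\to(0,1]$ with $\sum_{t\in T}P(t)=1$. It turns assembly into a Markov chain in which an assembly $A$ passes to an assembly $B$, obtainable from $A$ by attaching one tile, of type $t_{A\to B}$, with probability $P(t_{A\to B})/\sum_{C}P(t_{A\to C})$, the sum being over all assemblies $C$ obtainable from $A$ by attaching one tile. Theorem. There are aTAM tile systems $\Gamma_n=(T_n,\sigma_n,\tau_n)$, $n=1,2,3,\dots$, with $|T_n|=O(\log n)$ as $n\to\infty$, such that for every $n\ge 1$ the following holds: $\tau_n=2$; the seed $\sigma_n$ is a single tile; every producible assembly can grow into a terminal assembly; every terminal assembly of $\Gamma_n$ is a width-4 line, i.e. its tiles fill exactly a rectangle of $4$ rows and $\ell$ columns, for some length $\ell$;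 and for every concentration distribution $P$ over $T_n$ the assembly process terminates with probability $1$ and the expected length of the terminal assembly, $$\sum_{A \text{ terminal}} \mathrm{length}(A)\cdot\Pr_P[\Gamma_n\to A],$$ is exactly $n$, where $\Pr_P[\Gamma_n\to A]$ is the probability that the chain ends in $A$. -/

import Mathlib

open scoped ENNReal NNReal
open scoped Classical
open Filter Asymptotics

noncomputable section

namespace ATAM

/-- The four edges of a unit square tile. -/
inductive Dir
  | north | east | south | west
  deriving DecidableEq

namespace Dir

instance : Fintype Dir where
  elems := {north, east, south, west}
  complete := by intro d; cases d <;> simp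

/-- The edge of the neighbouring tile that touches the edge `d`. -/
def opp : Dir → Dir
  | north => south
  | east => west
  | south => north
  | west => east

/-- The displacement to the neighbouring position across the edge `d`. -/
def vec : Dir → ℤ × ℤ
  | north => (0, 1)
  | east => (1, 0)
  | south => (0, -1)
  | west => (-1, 0)

end Dir

/-- A tile type over the glue alphabet `G`: a glue on each edge and a finite string label.
Tiles are translated but never rotated. -/
structure Tile (G : Type) where
  glue : Dir → G
  label : String

/-- An assembly: a set of tiles at distinct positions of `ℤ²`, as a partial function. -/
abbrev Assembly (G : Type) : Type := ℤ × ℤ → Option (Tile G)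

namespace Assembly

variable {G : Type}

/-- The set of occupied positions. -/
def dom (α : Assembly G) : Set (ℤ × ℤ) := {p | α p ≠ none}

/-- The assembly `α ∪ {b}`, where `b` is the translation of `t` to the position `p`. -/
def add (α : Assembly G) (p : ℤ × ℤ) (t : Tile G) : Assembly G :=
  Function.update α p (some t)

/-- The weight of the edge of the bond graph between the position `p` and its neighbour in
direction `d`: the strength of the shared glue if the two abutting glues agree, and `0`
otherwise (also if one of the two positions is empty). -/
def bond (str : G → ℕ) (α : Assembly G) (p : ℤ × ℤ) (d : Dir) : ℕ :=
  match α p, α (p + d.vec) with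
  | some a, some b => if a.glue d = b.glue d.opp then str (a.glue d) else 0
  | _, _ => 0

/-- The total weight of the edges of the bond graph that leave the set `S` of positions. -/
def cutWeight (str : G → ℕ) (α : Assembly G) (S : Finset (ℤ × ℤ)) : ℕ :=
  ∑ p ∈ S, ∑ d : Dir, if p + d.vec ∈ S then 0 else bond str α p d

/-- `τ`-stability of a (finite) assembly: every cut of the bond graph into two non-empty
parts has weight at least `τ`. -/
def Stable (str : G → ℕ) (τ : ℕ) (α : Assembly G) : Prop :=
  ∀ S : Finset (ℤ × ℤ), S.Nonempty → (S : Set (ℤ × ℤ)) ⊂ α.dom → τ ≤ cutWeight str α S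

/-- The assembly is a line of width `w` and length `l`: its tiles fill exactly a rectangle of
`l` columns and `w` rows. -/
def IsLine (w l : ℕ) (α : Assembly G) : Prop :=
  ∃ a b : ℤ, α.dom = Set.Ico a (a + l) ×ˢ Set.Ico b (b + w)

/-- The length of a linear assembly: the number of columns that it occupies. -/
def length (α : Assembly G) : ℕ := (Prod.fst '' α.dom).ncard

end Assembly

/-- A tile system `Γ = (T, σ, τ)`, together with its glue alphabet and glue strengths. -/
structure TileSystem where
  Glue : Type
  str : Glue → ℕ
  /-- the tile set `T` -/
  tiles : Finset (Tile Glue)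
  /-- the seed `σ` -/
  seed : Assembly Glue
  /-- the temperature `τ` -/
  temp : ℕ
  temp_pos : 0 < temp
  seed_finite : seed.dom.Finite
  seed_nonempty : seed.dom.Nonempty
  seed_tiles : ∀ p t, seed p = some t → t ∈ tiles
  seed_stable : seed.Stable str temp

namespace TileSystem

variable (Γ : TileSystem)

/-- `A` grows into `B` through a single attachment of a tile of type `t`. -/
def Attach (A : Assembly Γ.Glue) (t : Tile Γ.Glue) (B : Assembly Γ.Glue) : Prop :=
  t ∈ Γ.tiles ∧ ∃ p, A p = none ∧ B = A.add p t ∧ B.Stable Γ.str Γ.temp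

/-- `A →₁ B`: growth through a single tile attachment. -/
def Step (A B : Assembly Γ.Glue) : Prop := ∃ t, Γ.Attach A t B

/-- `A → B`: growth through zero or more tile attachments. -/
def Grows : Assembly Γ.Glue → Assembly Γ.Glue → Prop := Relation.ReflTransGen Γ.Step

/-- Producible assemblies. -/
def Producible (A : Assembly Γ.Glue) : Prop := Γ.Grows Γ.seed A

/-- Terminal assemblies: producible, and no further tile may attach. -/
def Terminal (A : Assembly Γ.Glue) : Prop := Γ.Producible A ∧ ∀ B, ¬ Γ.Step A B

/-- Every producible assembly can grow into a terminal assembly. -/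
def IsFinite : Prop := ∀ B, Γ.Producible B → ∃ A, Γ.Terminal A ∧ Γ.Grows B A

/-- Concentration distributions over the tile set (values off the tile set play no role). -/
def IsConcentration (P : Tile Γ.Glue → ℝ≥0) : Prop :=
  (∀ t ∈ Γ.tiles, 0 < P t) ∧ ∑ t ∈ Γ.tiles, P t = 1

/-- The concentration of the tile type whose attachment turns `A` into `B`, and `0` if `A →₁ B`
fails. (That tile type is unique, so at most one summand is non-zero.) -/
def weight (P : Tile Γ.Glue → ℝ≥0) (A B : Assembly Γ.Glue) : ℝ≥0∞ :=
  ∑ t ∈ Γ.tiles, if Γ.Attach A t B then (P t : ℝ≥0∞) else 0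

/-- The transition probability of the assembly process from `A` to `B`. -/
def trans (P : Tile Γ.Glue → ℝ≥0) (A B : Assembly Γ.Glue) : ℝ≥0∞ :=
  Γ.weight P A B / ∑' C, Γ.weight P A C

/-- The probability that the assembly process, started at the seed and stopped when no tile can
attach, makes at least `k` transitions and is in the state `A` after exactly `k` of them. -/
def probAt (P : Tile Γ.Glue → ℝ≥0) : ℕ → Assembly Γ.Glue → ℝ≥0∞
  | 0, A => if A = Γ.seed then 1 else 0
  | k + 1, B => ∑' A, probAt P k A * Γ.trans P A B

/-- The probability that the system terminally assembles the terminal assembly `A`: the process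
arrives in `A` after some number of transitions (and then stays there). -/
def probTerm (P : Tile Γ.Glue → ℝ≥0) (A : Assembly Γ.Glue) : ℝ≥0∞ :=
  ∑' k, Γ.probAt P k A

/-- The probability that the assembly process terminates. -/
def totalProb (P : Tile Γ.Glue → ℝ≥0) : ℝ≥0∞ :=
  ∑' A : {A : Assembly Γ.Glue // Γ.Terminal A}, Γ.probTerm P A.1

/-- The expected length of the terminal assembly. -/
def expectedLength (P : Tile Γ.Glue → ℝ≥0) : ℝ≥0∞ :=
  ∑' A : {A : Assembly Γ.Glue // Γ.Terminal A}, (A.1.length : ℝ≥0∞) * Γ.probTerm P A.1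

end TileSystem

end ATAM

end

/-!
A line is a sequence of rectangular blocks of four rows that count down like a counter. The block of
the value `i` is entered through a glue of strength `2` and left through one of two exits: towards
the block of the value `i - 1`, or back to the largest value `top`. The line ends at the value `0`.

Most blocks are single columns, which always decrease the counter. The others are coins of five
columns that choose between the two exits by a race: the exit is decided by which of two paths is
first to reach a certain position. One path consists of a tile of type `15` followed by one of type
`16`, the other of the same types in the opposite order, so that each exit has probability `1 / 2`
whatever the concentrations are.

If `G i` is the difference between the expected numbers of columns built after the values `top` and
`i`, a column gives `G i = G (i + 1) + 1` and a coin gives `G i = 2 * G (i + 1) + 10`, while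
`G top = 0` and the expected length is `G 0 + 1`. Choosing the blocks according to the binary digits
of `n`, one reaches `G 0 = n - 1` with `O(log n)` blocks of at most `20` tile types each.

To transfer this to the assembly process, the expected length given the present assembly is
expressed by an explicit function of the producible assemblies. It is harmonic for the process and
comparable to the number of tiles. The number of tiles grows by one in each step, so the bounded
mean of this function forces termination with probability `1`, and the part of the mean that comes
from unfinished processes vanishes in the limit; what remains is the expected length.
-/

noncomputable section

namespace ATAM

section Stopping

variable {d r u v : ℕ → ℝ≥0∞}

theorem tendsto_natCast_mul_of_antitone {f : ℕ → ℝ≥0∞} (hf : Antitone f)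
    (hsum : ∑' k, f k ≠ ⊤) : Tendsto (fun n : ℕ => n * f n) atTop (nhds 0) := by
  have htail : Tendsto (fun n : ℕ => 2 * ∑' k, f (k + n / 2)) atTop (nhds 0) := by
    simpa using ENNReal.Tendsto.const_mul
      ((ENNReal.tendsto_sum_nat_add f hsum).comp (Nat.tendsto_div_const_atTop two_ne_zero))
      (Or.inr ENNReal.ofNat_ne_top)
  refine tendsto_of_tendsto_of_tendsto_of_le_of_le tendsto_const_nhds htail (fun _ => bot_le) ?_
  intro n
  calc (n : ℝ≥0∞) * f n ≤ ((2 * (n - n / 2) : ℕ) : ℝ≥0∞) * f n := by gcongr; lia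
    _ = 2 * ∑ _k ∈ Finset.range (n - n / 2), f n := by simp [mul_assoc]
    _ ≤ 2 * ∑ k ∈ Finset.range (n - n / 2), f (k + n / 2) := by
      gcongr with k hk
      exact hf (by have := Finset.mem_range.1 hk; lia)
    _ ≤ 2 * ∑' k, f (k + n / 2) := by gcongr; exact ENNReal.sum_le_tsum _

theorem sum_range_add_eq_of_eq_add_succ (h : ∀ k, r k = d k + r (k + 1)) (n : ℕ) :
    ∑ k ∈ Finset.range n, d k + r n = r 0 := by
  induction n with
  | zero => simp
  | succ n ih => rw [Finset.sum_range_succ, add_assoc, ← h, ih]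

theorem tsum_eq_of_eq_add_succ (h : ∀ k, r k = d k + r (k + 1))
    (hr : Tendsto r atTop (nhds 0)) : ∑' k, d k = r 0 := by
  have hlim := (ENNReal.summable (f := d)).hasSum.tendsto_sum_nat.add hr
  simp only [sum_range_add_eq_of_eq_add_succ h, add_zero] at hlim
  exact tendsto_nhds_unique hlim tendsto_const_nhds

theorem sum_range_succ_eq_of_eq_add_succ (h : ∀ k, r k = d k + r (k + 1)) (n : ℕ) :
    ∑ k ∈ Finset.range n, r (k + 1) = ∑ k ∈ Finset.range n, k * d k + n * r n := by
  induction n with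
  | zero => simp
  | succ n ih =>
    rw [Finset.sum_range_succ, Finset.sum_range_succ, ih, h n]
    push_cast
    ring

theorem tsum_ne_top_of_natCast_mul_le {a : ℝ≥0∞} (ha : a ≠ ⊤) (hu0 : u 0 ≠ ⊤) (hr0 : r 0 ≠ ⊤)
    (hr : ∀ k, r k = d k + r (k + 1)) (hu : ∀ k, u k = v k + u (k + 1))
    (hd : ∀ k : ℕ, k * d k ≤ a * v k) (hru : ∀ k : ℕ, k * r k ≤ a * u k) :
    ∑' k, r k ≠ ⊤ := by
  rw [tsum_eq_zero_add' ENNReal.summable]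
  refine ENNReal.add_ne_top.2 ⟨hr0, ne_top_of_le_ne_top (ENNReal.mul_ne_top ha hu0) ?_⟩
  refine ENNReal.tsum_le_of_sum_range_le fun n => ?_
  calc ∑ k ∈ Finset.range n, r (k + 1)
      = ∑ k ∈ Finset.range n, k * d k + n * r n := sum_range_succ_eq_of_eq_add_succ hr n
    _ ≤ ∑ k ∈ Finset.range n, a * v k + a * u n :=
      add_le_add (Finset.sum_le_sum fun k _ => hd k) (hru n)
    _ = a * u 0 := by rw [← Finset.mul_sum, ← mul_add, sum_range_add_eq_of_eq_add_succ hu]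

/-- The situation is that `r k` is the probability of at least `k` steps and `u k` the mean of a
size over the processes that make these steps, while `d k` and `v k` count those that then stop.
Summation by parts bounds the expected number of steps, so `k * r k` tends to `0` as well. -/
theorem tendsto_zero_of_linear_growth {a c : ℝ≥0∞} (ha : a ≠ ⊤) (hc : c ≠ ⊤) (hr0 : r 0 ≠ ⊤)
    (hr : ∀ k, r k = d k + r (k + 1)) (hu : ∀ k, u k = v k + u (k + 1))
    (hd : ∀ k : ℕ, k * d k ≤ a * v k) (hru : ∀ k : ℕ, k * r k ≤ a * u k)
    (hur : ∀ k : ℕ, u k ≤ (k + c) * r k) :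
    Tendsto r atTop (nhds 0) ∧ Tendsto u atTop (nhds 0) := by
  have hu0 : u 0 ≠ ⊤ := ne_top_of_le_ne_top (ENNReal.mul_ne_top (by simpa using hc) hr0) (hur 0)
  have hsum : ∑' k, r k ≠ ⊤ := tsum_ne_top_of_natCast_mul_le ha hu0 hr0 hr hu hd hru
  have hanti : Antitone r := antitone_nat_of_succ_le fun k => (hr k).symm ▸ le_add_self
  have hr_lim : Tendsto r atTop (nhds 0) := ENNReal.tendsto_atTop_zero_of_tsum_ne_top hsum
  refine ⟨hr_lim, tendsto_of_tendsto_of_tendsto_of_le_of_le tendsto_const_nhds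
    (h := fun k : ℕ => k * r k + c * r k) ?_ (fun _ => bot_le) fun k => ?_⟩
  · simpa using (tendsto_natCast_mul_of_antitone hanti hsum).add
      (ENNReal.Tendsto.const_mul hr_lim (Or.inr hc))
  · simpa only [add_mul] using hur k

end Stopping

namespace Dir

theorem opp_opp (d : Dir) : d.opp.opp = d := by cases d <;> rfl

theorem vec_opp (d : Dir) : d.opp.vec = -d.vec := by cases d <;> rfl

theorem vec_ne_zero (d : Dir) : d.vec ≠ 0 := by cases d <;> simp [vec, Prod.ext_iff]

theorem sum_opp {M : Type*} [AddCommMonoid M] (f : Dir → M) : ∑ d : Dir, f d.opp = ∑ d, f d :=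
  Equiv.sum_comp ⟨opp, opp, opp_opp, opp_opp⟩ f

end Dir

/-- The strength with which a tile of type `t` is bound across its edge `d` to the content of the
neighbouring position. -/
def Tile.touch {G : Type} (str : G → ℕ) (t : Tile G) (d : Dir) : Option (Tile G) → ℕ
  | some b => if t.glue d = b.glue d.opp then str (t.glue d) else 0
  | none => 0

namespace Assembly

variable {G : Type} {str : G → ℕ} {α : Assembly G} {p q : ℤ × ℤ} {t : Tile G} {S : Finset (ℤ × ℤ)}

/-- The total strength with which a tile of type `t` at the position `p` would be bound to `α`. -/
def binding (str : G → ℕ) (α : Assembly G) (p : ℤ × ℤ) (t : Tile G) : ℕ :=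
  ∑ d : Dir, t.touch str d (α (p + d.vec))

theorem mem_dom : p ∈ α.dom ↔ α p ≠ none := Iff.rfl

theorem add_self (α : Assembly G) (p : ℤ × ℤ) (t : Tile G) : α.add p t p = some t :=
  Function.update_self ..

theorem add_of_ne (α : Assembly G) (t : Tile G) (h : q ≠ p) : α.add p t q = α q :=
  Function.update_of_ne h ..

theorem dom_add (α : Assembly G) (p : ℤ × ℤ) (t : Tile G) : (α.add p t).dom = insert p α.dom := by
  ext q
  by_cases h : q = p
  · simp [h, mem_dom, add_self]
  · simp [h, mem_dom, add_of_ne α t h]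

theorem add_injective (hp : α p = none) {t' : Tile G} (h : α.add p t = α.add q t') :
    p = q ∧ t = t' := by
  have hpq : p = q := by
    by_contra hne
    have := congrFun h p
    rw [add_self, add_of_ne α t' hne, hp] at this
    exact Option.some_ne_none t this
  subst hpq
  have := congrFun h p
  rw [add_self, add_self] at this
  exact ⟨rfl, Option.some_injective _ this⟩

theorem add_vec_ne (p : ℤ × ℤ) (d : Dir) : p + d.vec ≠ p := by simpa using d.vec_ne_zero

theorem bond_add_self (str : G → ℕ) (α : Assembly G) (p : ℤ × ℤ) (t : Tile G) (d : Dir) :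
    bond str (α.add p t) p d = t.touch str d (α (p + d.vec)) := by
  rw [bond, add_self, add_of_ne α t (add_vec_ne p d)]
  cases α (p + d.vec) <;> rfl

theorem bond_add_of_ne (d : Dir) (hq : q ≠ p) (hqd : q + d.vec ≠ p) :
    bond str (α.add p t) q d = bond str α q d := by
  simp only [bond, add_of_ne α t hq, add_of_ne α t hqd]

theorem bond_symm (str : G → ℕ) (α : Assembly G) (p : ℤ × ℤ) (d : Dir) :
    bond str α (p + d.vec) d.opp = bond str α p d := by
  rw [bond, bond, Dir.vec_opp, add_neg_cancel_right, Dir.opp_opp]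
  cases α p with
  | none => cases α (p + d.vec) <;> rfl
  | some a =>
    cases α (p + d.vec) with
    | none => rfl
    | some b =>
      by_cases h : a.glue d = b.glue d.opp
      · simp only [h]
      · simp only [if_neg h, if_neg (Ne.symm h)]

theorem bond_eq_zero (d : Dir) (h : α (q + d.vec) = none) : bond str α q d = 0 := by
  rw [bond, h]
  cases α q <;> rfl

theorem cutWeight_singleton (str : G → ℕ) (α : Assembly G) (p : ℤ × ℤ) :
    cutWeight str α {p} = ∑ d, bond str α p d := by
  simp only [cutWeight, Finset.sum_singleton, Finset.mem_singleton, add_vec_ne, if_false]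

theorem cutWeight_singleton_add (str : G → ℕ) (α : Assembly G) (p : ℤ × ℤ) (t : Tile G) :
    cutWeight str (α.add p t) {p} = binding str α p t := by
  simp only [cutWeight_singleton, bond_add_self, binding]

theorem cutWeight_erase_le_cutWeight_add (hp : α p = none) :
    cutWeight str α (S.erase p) ≤ cutWeight str (α.add p t) S := by
  refine le_trans (Finset.sum_le_sum fun q hq => Finset.sum_le_sum fun d _ => ?_)
    (Finset.sum_le_sum_of_subset (Finset.erase_subset p S))
  by_cases hd : q + d.vec = p
  · simp [bond_eq_zero d (hd ▸ hp)]
  · simp [bond_add_of_ne d (Finset.ne_of_mem_erase hq) hd, hd]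

theorem sum_bond_eq (str : G → ℕ) (α : Assembly G) (p : ℤ × ℤ) (S : Finset (ℤ × ℤ)) :
    ∑ q ∈ S, ∑ d : Dir, (if q + d.vec = p then bond str α q d else 0) =
      ∑ d : Dir, if p + d.vec ∈ S then bond str α p d else 0 := by
  rw [Finset.sum_comm, ← Dir.sum_opp]
  refine Finset.sum_congr rfl fun d _ => ?_
  have hterm (q : ℤ × ℤ) : (if q + d.opp.vec = p then bond str α q d.opp else 0) =
      if q = p + d.vec then bond str α p d else 0 := by
    have hiff : q + d.opp.vec = p ↔ q = p + d.vec := by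
      rw [Dir.vec_opp, ← sub_eq_add_neg, sub_eq_iff_eq_add]
    by_cases h : q = p + d.vec
    · rw [if_pos h, if_pos (hiff.2 h), h, bond_symm]
    · rw [if_neg h, if_neg (hiff.not.2 h)]
  simp only [hterm, Finset.sum_ite_eq']

theorem binding_le_cutWeight_add (hp : p ∉ S) (hS : α.dom ⊆ S) :
    binding str α p t ≤ cutWeight str (α.add p t) S := by
  calc binding str α p t
      ≤ ∑ d : Dir, if p + d.vec ∈ S then bond str (α.add p t) p d else 0 := by
        refine Finset.sum_le_sum fun d _ => ?_
        rw [bond_add_self]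
        split_ifs with h
        · exact le_rfl
        · rw [not_not.1 (mt (@hS (p + d.vec)) h)]
          exact le_rfl
    _ = ∑ q ∈ S, ∑ d : Dir, (if q + d.vec = p then bond str (α.add p t) q d else 0) :=
        (sum_bond_eq ..).symm
    _ ≤ cutWeight str (α.add p t) S := by
        refine Finset.sum_le_sum fun q _ => Finset.sum_le_sum fun d _ => ?_
        by_cases h : q + d.vec = p
        · rw [if_pos h, if_neg (h ▸ hp)]
        · rw [if_neg h]
          exact Nat.zero_le _

theorem stable_add_iff {τ : ℕ} (hα : α.Stable str τ) (hne : α.dom.Nonempty) (hp : α p = none) :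
    (α.add p t).Stable str τ ↔ τ ≤ binding str α p t := by
  have hpd : p ∉ α.dom := fun h => h hp
  constructor
  · intro h
    rw [← cutWeight_singleton_add]
    refine h {p} (Finset.singleton_nonempty p) ?_
    rw [dom_add, Finset.coe_singleton]
    obtain ⟨q, hq⟩ := hne
    exact ⟨by simp, fun h' => hpd (h' (Set.mem_insert_of_mem _ hq) ▸ hq)⟩
  intro h S hS hSd
  rw [dom_add] at hSd
  have hsub : ((S.erase p : Finset _) : Set (ℤ × ℤ)) ⊆ α.dom := fun q hq =>
    (hSd.1 (Finset.mem_of_mem_erase hq)).resolve_left (Finset.ne_of_mem_erase hq)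
  by_cases hSp : S = {p}
  · rwa [hSp, cutWeight_singleton_add]
  by_cases hdom : ((S.erase p : Finset _) : Set (ℤ × ℤ)) = α.dom
  · have hpS : p ∉ S := fun hpS => hSd.2 <| by
      rw [← hdom, Finset.coe_erase]
      simp [hpS]
    exact h.trans (binding_le_cutWeight_add hpS (by rw [← hdom, Finset.erase_eq_of_notMem hpS]))
  · have herase : (S.erase p).Nonempty := by
      rw [Finset.nonempty_iff_ne_empty, Ne, Finset.erase_eq_empty_iff]
      exact not_or.2 ⟨hS.ne_empty, hSp⟩
    exact (hα _ herase (hsub.ssubset_of_ne hdom)).trans (cutWeight_erase_le_cutWeight_add hp)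

end Assembly

namespace TileSystem

variable {Γ : TileSystem} {A B : Assembly Γ.Glue} {P : Tile Γ.Glue → ℝ≥0}

/-- The single-tile attachments available to `A`, as pairs of a position and a tile type. -/
def attachments (Γ : TileSystem) (A : Assembly Γ.Glue) : Set ((ℤ × ℤ) × Tile Γ.Glue) :=
  {a | a.2 ∈ Γ.tiles ∧ A a.1 = none ∧ (A.add a.1 a.2).Stable Γ.str Γ.temp}

theorem attach_iff {t : Tile Γ.Glue} :
    Γ.Attach A t B ↔ ∃ p, (p, t) ∈ Γ.attachments A ∧ B = A.add p t := by
  constructor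
  · rintro ⟨ht, p, hp, rfl, hB⟩
    exact ⟨p, ⟨ht, hp, hB⟩, rfl⟩
  · rintro ⟨p, ⟨ht, hp, hB⟩, rfl⟩
    exact ⟨ht, p, hp, rfl, hB⟩

theorem step_iff : Γ.Step A B ↔ ∃ a ∈ Γ.attachments A, B = A.add a.1 a.2 := by
  simp only [Step, attach_iff, Prod.exists (α := ℤ × ℤ)]
  exact exists_comm

theorem Step.dom_eq (h : Γ.Step A B) : ∃ p ∉ A.dom, B.dom = insert p A.dom := by
  obtain ⟨⟨p, t⟩, ⟨-, hp, -⟩, rfl⟩ := step_iff.1 h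
  exact ⟨p, not_not.2 hp, Assembly.dom_add A p t⟩

theorem Step.finite_dom (h : Γ.Step A B) (hA : A.dom.Finite) : B.dom.Finite := by
  obtain ⟨p, -, hB⟩ := h.dom_eq
  exact hB ▸ hA.insert p

theorem Step.ncard_dom (h : Γ.Step A B) (hA : A.dom.Finite) :
    B.dom.ncard = A.dom.ncard + 1 := by
  obtain ⟨p, hp, hB⟩ := h.dom_eq
  rw [hB, Set.ncard_insert_of_notMem hp hA]

theorem Producible.step (hA : Γ.Producible A) (h : Γ.Step A B) : Γ.Producible B :=
  Relation.ReflTransGen.tail hA h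

theorem Producible.induction_on {p : Assembly Γ.Glue → Prop} (hA : Γ.Producible A)
    (seed : p Γ.seed) (step : ∀ A B, Γ.Producible A → p A → Γ.Step A B → p B) : p A := by
  induction hA with
  | refl => exact seed
  | tail h hs ih => exact step _ _ h ih hs

theorem Producible.finite_dom (hA : Γ.Producible A) : A.dom.Finite :=
  hA.induction_on Γ.seed_finite fun _ _ _ hA h => h.finite_dom hA

theorem Producible.nonempty_dom (hA : Γ.Producible A) : A.dom.Nonempty :=
  hA.induction_on Γ.seed_nonempty fun _ _ _ _ h => by
    obtain ⟨p, -, hB⟩ := h.dom_eq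
    exact hB ▸ Set.insert_nonempty p _

theorem Producible.stable (hA : Γ.Producible A) : A.Stable Γ.str Γ.temp :=
  hA.induction_on Γ.seed_stable fun _ _ _ _ ⟨_, _, _, _, _, hB⟩ => hB

theorem Producible.mem_attachments_iff (hA : Γ.Producible A) {a : (ℤ × ℤ) × Tile Γ.Glue} :
    a ∈ Γ.attachments A ↔
      a.2 ∈ Γ.tiles ∧ A a.1 = none ∧ Γ.temp ≤ A.binding Γ.str a.1 a.2 :=
  and_congr_right fun _ => and_congr_right fun hp =>
    Assembly.stable_add_iff hA.stable hA.nonempty_dom hp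

theorem Producible.finite_attachments (hA : Γ.Producible A) : (Γ.attachments A).Finite := by
  refine ((Set.Finite.image2 (fun q (d : Dir) => q - d.vec) hA.finite_dom Set.finite_univ).prod
    Γ.tiles.finite_toSet).subset ?_
  rintro ⟨p, t⟩ ha
  obtain ⟨ht, -, hbind⟩ := hA.mem_attachments_iff.1 ha
  obtain ⟨d, -, hd⟩ := Finset.exists_ne_zero_of_sum_ne_zero (Γ.temp_pos.trans_le hbind).ne'
  refine ⟨⟨p + d.vec, fun h => hd ?_, d, trivial, add_sub_cancel_right ..⟩, ht⟩
  rw [h, Tile.touch]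

theorem tsum_weight_mul (P : Tile Γ.Glue → ℝ≥0) (A : Assembly Γ.Glue)
    (g : Assembly Γ.Glue → ℝ≥0∞) :
    ∑' B, Γ.weight P A B * g B = ∑' a : Γ.attachments A, P a.1.2 * g (A.add a.1.1 a.1.2) := by
  let f (x : Assembly Γ.Glue × Tile Γ.Glue) : ℝ≥0∞ :=
    if Γ.Attach A x.2 x.1 then P x.2 * g x.1 else 0
  let e (a : Γ.attachments A) : Assembly Γ.Glue × Tile Γ.Glue := (A.add a.1.1 a.1.2, a.1.2)
  have he : Function.Injective e := by
    rintro ⟨⟨p, t⟩, ht, hp, hB⟩ ⟨⟨q, t'⟩, h'⟩ h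
    obtain ⟨rfl, rfl⟩ := Assembly.add_injective hp (congrArg Prod.fst h)
    rfl
  have hf : Function.support f ⊆ Set.range e := by
    rintro ⟨B, t⟩ h
    obtain ⟨p, hp, rfl : B = A.add p t⟩ := attach_iff.1 (not_imp_comm.1 (if_neg (α := ℝ≥0∞)) h)
    exact ⟨⟨(p, t), hp⟩, rfl⟩
  calc ∑' B, Γ.weight P A B * g B = ∑' B, ∑' t, f (B, t) := by
        refine tsum_congr fun B => ?_
        rw [tsum_eq_sum (s := Γ.tiles) fun t ht => if_neg fun h => ht h.1, weight,
          Finset.sum_mul]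
        simp only [ite_mul, zero_mul]
    _ = ∑' x, f x := (ENNReal.tsum_prod' (f := f)).symm
    _ = ∑' a, f (e a) := (he.tsum_eq hf).symm
    _ = _ := tsum_congr fun a => if_pos (attach_iff.2 ⟨a.1.1, a.2, rfl⟩)

theorem tsum_weight (P : Tile Γ.Glue → ℝ≥0) (A : Assembly Γ.Glue) :
    ∑' B, Γ.weight P A B = ∑' a : Γ.attachments A, (P a.1.2 : ℝ≥0∞) := by
  simpa using tsum_weight_mul P A 1

theorem Producible.tsum_weight_ne_top (hA : Γ.Producible A) : ∑' B, Γ.weight P A B ≠ ⊤ := by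
  have := hA.finite_attachments.fintype
  rw [tsum_weight, tsum_fintype]
  exact ENNReal.sum_ne_top.2 fun _ _ => ENNReal.coe_ne_top

theorem weight_ne_zero_iff (hP : ∀ t ∈ Γ.tiles, 0 < P t) :
    Γ.weight P A B ≠ 0 ↔ Γ.Step A B := by
  have hterm {t} (h : Γ.Attach A t B) : P t ≠ 0 := (hP t h.1).ne'
  simp only [weight, ne_eq, Finset.sum_eq_zero_iff, ite_eq_right_iff, ENNReal.coe_eq_zero, Step,
    not_forall]
  exact ⟨fun ⟨t, _, h, _⟩ => ⟨t, h⟩, fun ⟨t, h⟩ => ⟨t, h.1, h, hterm h⟩⟩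

theorem Producible.trans_ne_zero_iff (hA : Γ.Producible A) (hP : ∀ t ∈ Γ.tiles, 0 < P t) :
    Γ.trans P A B ≠ 0 ↔ Γ.Step A B := by
  rw [trans, ENNReal.div_ne_zero, weight_ne_zero_iff hP, and_iff_left hA.tsum_weight_ne_top]

theorem tsum_trans_mul (P : Tile Γ.Glue → ℝ≥0) (A : Assembly Γ.Glue)
    (g : Assembly Γ.Glue → ℝ≥0∞) :
    ∑' B, Γ.trans P A B * g B = (∑' B, Γ.weight P A B * g B) / ∑' B, Γ.weight P A B := by
  simp only [trans, div_eq_mul_inv, mul_right_comm _ (_⁻¹), ENNReal.tsum_mul_right]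

/-- A function on assemblies is harmonic at `A` if the next attachment does not change its
expected value; the normalization of the transition probabilities is cleared. -/
def HarmonicAt (Γ : TileSystem) (P : Tile Γ.Glue → ℝ≥0) (g : Assembly Γ.Glue → ℝ≥0∞)
    (A : Assembly Γ.Glue) : Prop :=
  ∑' a : Γ.attachments A, P a.1.2 * g (A.add a.1.1 a.1.2) =
    (∑' a : Γ.attachments A, (P a.1.2 : ℝ≥0∞)) * g A

theorem Producible.harmonicAt_of_list (hA : Γ.Producible A) {h : Assembly Γ.Glue → ℝ≥0}
    {Y : List ((ℤ × ℤ) × Tile Γ.Glue)} (hY : Y.Nodup) (hsub : ∀ a ∈ Y, a ∈ Γ.attachments A)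
    (hoff : ∀ a ∈ Γ.attachments A, a ∉ Y → h (A.add a.1 a.2) = h A)
    (hsum : (Y.map fun a => P a.2 * h (A.add a.1 a.2)).sum = (Y.map fun a => P a.2).sum * h A) :
    Γ.HarmonicAt P (fun A => h A) A := by
  obtain ⟨F, hF⟩ := hA.finite_attachments.exists_finset_coe
  have hYF : Y.toFinset ⊆ F := fun a ha => by
    rw [← Finset.mem_coe, hF]
    exact hsub a (List.mem_toFinset.1 ha)
  have hoffF : ∀ a ∈ F \ Y.toFinset, P a.2 * h (A.add a.1 a.2) = P a.2 * h A := fun a ha => by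
    rw [Finset.mem_sdiff, List.mem_toFinset] at ha
    rw [hoff a (hF ▸ Finset.mem_coe.2 ha.1) ha.2]
  have hbalance : ∑ a ∈ F, P a.2 * h (A.add a.1 a.2) = (∑ a ∈ F, P a.2) * h A := by
    rw [← Finset.sum_sdiff hYF, ← Finset.sum_sdiff hYF, Finset.sum_congr rfl hoffF,
      List.sum_toFinset _ hY, List.sum_toFinset _ hY, hsum, add_mul, Finset.sum_mul]
  rw [HarmonicAt, ← hF, F.tsum_subtype' fun a => P a.2 * (h (A.add a.1 a.2) : ℝ≥0∞),
    F.tsum_subtype' fun a => (P a.2 : ℝ≥0∞)]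
  exact_mod_cast hbalance

theorem harmonicAt_one (P : Tile Γ.Glue → ℝ≥0) (A : Assembly Γ.Glue) : Γ.HarmonicAt P 1 A := by
  simp [HarmonicAt]

/-- The function `g` restricted to the terminal assemblies, where the process stops. -/
def onTerminal (Γ : TileSystem) (g : Assembly Γ.Glue → ℝ≥0∞) (A : Assembly Γ.Glue) : ℝ≥0∞ :=
  if Γ.Terminal A then g A else 0

theorem HarmonicAt.eq_onTerminal_add (hP : ∀ t ∈ Γ.tiles, 0 < P t)
    {g : Assembly Γ.Glue → ℝ≥0∞} (hA : Γ.Producible A) (hg : Γ.HarmonicAt P g A) :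
    g A = Γ.onTerminal g A + ∑' B, Γ.trans P A B * g B := by
  by_cases hT : Γ.Terminal A
  · have htrans (B) : Γ.trans P A B = 0 :=
      not_not.1 (mt (hA.trans_ne_zero_iff hP).1 (hT.2 B))
    simp [onTerminal, hT, htrans]
  · obtain ⟨B, hB⟩ : ∃ B, Γ.Step A B := by simpa [Terminal, hA] using hT
    have hne : ∑' B, Γ.weight P A B ≠ 0 := fun h =>
      (weight_ne_zero_iff hP).2 hB (ENNReal.tsum_eq_zero.1 h B)
    rw [onTerminal, if_neg hT, zero_add, tsum_trans_mul, tsum_weight_mul, hg, ← tsum_weight,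
      mul_comm, ENNReal.mul_div_cancel_right hne hA.tsum_weight_ne_top]

/-- The contribution to the expectation of `g` of the processes that make at least `k`
transitions. -/
def expectAt (Γ : TileSystem) (P : Tile Γ.Glue → ℝ≥0) (k : ℕ) (g : Assembly Γ.Glue → ℝ≥0∞) :
    ℝ≥0∞ :=
  ∑' A, Γ.probAt P k A * g A

theorem expectAt_zero (P : Tile Γ.Glue → ℝ≥0) (g : Assembly Γ.Glue → ℝ≥0∞) :
    Γ.expectAt P 0 g = g Γ.seed := by
  simp [expectAt, probAt]

theorem expectAt_succ (P : Tile Γ.Glue → ℝ≥0) (k : ℕ) (g : Assembly Γ.Glue → ℝ≥0∞) :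
    Γ.expectAt P (k + 1) g = Γ.expectAt P k fun A => ∑' B, Γ.trans P A B * g B := by
  simp only [expectAt, probAt, ← ENNReal.tsum_mul_right, ← ENNReal.tsum_mul_left, mul_assoc]
  exact ENNReal.tsum_comm

theorem producible_of_probAt_ne_zero {k : ℕ} (hP : ∀ t ∈ Γ.tiles, 0 < P t)
    (h : Γ.probAt P k A ≠ 0) : Γ.Producible A ∧ A.dom.ncard = k + Γ.seed.dom.ncard := by
  induction k generalizing A with
  | zero =>
    obtain rfl : A = Γ.seed := not_imp_comm.1 (if_neg (α := ℝ≥0∞)) h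
    exact ⟨Relation.ReflTransGen.refl, (zero_add _).symm⟩
  | succ k ih =>
    obtain ⟨B, hB⟩ := not_forall.1 (mt ENNReal.tsum_eq_zero.2 h)
    obtain ⟨hprod, hcard⟩ := ih (left_ne_zero_of_mul hB)
    have hstep := (hprod.trans_ne_zero_iff hP).1 (right_ne_zero_of_mul hB)
    exact ⟨hprod.step hstep, by rw [hstep.ncard_dom hprod.finite_dom, hcard]; ring⟩

theorem Producible.exists_probAt_ne_zero (hA : Γ.Producible A) (hP : ∀ t ∈ Γ.tiles, 0 < P t) :
    ∃ k, Γ.probAt P k A ≠ 0 := by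
  refine hA.induction_on (p := fun A => ∃ k, Γ.probAt P k A ≠ 0) ⟨0, by simp [probAt]⟩ ?_
  refine fun A B hA ⟨k, hk⟩ h => ⟨k + 1, fun hzero => ?_⟩
  exact mul_ne_zero hk ((hA.trans_ne_zero_iff hP).2 h) (ENNReal.tsum_eq_zero.1 hzero A)

theorem expectAt_mono (hP : ∀ t ∈ Γ.tiles, 0 < P t) {k : ℕ} {g g' : Assembly Γ.Glue → ℝ≥0∞}
    (h : ∀ A, Γ.Producible A → A.dom.ncard = k + Γ.seed.dom.ncard → g A ≤ g' A) :
    Γ.expectAt P k g ≤ Γ.expectAt P k g' := by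
  refine ENNReal.tsum_le_tsum fun A => ?_
  by_cases h0 : Γ.probAt P k A = 0
  · simp [h0]
  · gcongr
    exact (producible_of_probAt_ne_zero hP h0).elim (h A)

theorem expectAt_congr (hP : ∀ t ∈ Γ.tiles, 0 < P t) {k : ℕ} {g g' : Assembly Γ.Glue → ℝ≥0∞}
    (h : ∀ A, Γ.Producible A → g A = g' A) : Γ.expectAt P k g = Γ.expectAt P k g' :=
  le_antisymm (expectAt_mono hP fun A hA _ => (h A hA).le)
    (expectAt_mono hP fun A hA _ => (h A hA).ge)

theorem expectAt_const_mul (P : Tile Γ.Glue → ℝ≥0) (k : ℕ) (c : ℝ≥0∞)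
    (g : Assembly Γ.Glue → ℝ≥0∞) :
    Γ.expectAt P k (fun A => c * g A) = c * Γ.expectAt P k g := by
  simp only [expectAt, mul_left_comm _ c, ENNReal.tsum_mul_left]

theorem expectAt_eq_add (hP : ∀ t ∈ Γ.tiles, 0 < P t) {g : Assembly Γ.Glue → ℝ≥0∞}
    (hg : ∀ A, Γ.Producible A → Γ.HarmonicAt P g A) (k : ℕ) :
    Γ.expectAt P k g =
      Γ.expectAt P k (Γ.onTerminal g) + Γ.expectAt P (k + 1) g := by
  rw [expectAt_succ, expectAt_congr hP fun A hA => (hg A hA).eq_onTerminal_add hP hA]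
  simp only [expectAt, mul_add, ENNReal.tsum_add]

theorem tsum_expectAt_onTerminal (P : Tile Γ.Glue → ℝ≥0) (g : Assembly Γ.Glue → ℝ≥0∞) :
    ∑' k, Γ.expectAt P k (Γ.onTerminal g) =
      ∑' A : {A // Γ.Terminal A}, g A * Γ.probTerm P A := by
  simp only [expectAt, probTerm]
  rw [ENNReal.tsum_comm]
  refine Eq.trans (tsum_congr fun A => ?_)
    (tsum_subtype {A | Γ.Terminal A} fun A => g A * ∑' k, Γ.probAt P k A).symm
  by_cases hT : Γ.Terminal A <;> simp [onTerminal, hT, ENNReal.tsum_mul_left, mul_comm]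

/-- A function on assemblies that is harmonic for the assembly process and of the order of the
number of tiles: the expected value of such a function survives in the limit. -/
structure IsHarmonicSize (Γ : TileSystem) (P : Tile Γ.Glue → ℝ≥0)
    (h : Assembly Γ.Glue → ℝ≥0) : Prop where
  harmonicAt : ∀ A, Γ.Producible A → Γ.HarmonicAt P (fun A => h A) A
  exists_ncard_le : ∃ a : ℝ≥0, ∀ A, Γ.Producible A → A.dom.ncard ≤ a * h A
  exists_le_ncard : ∃ c : ℝ≥0, ∀ A, Γ.Producible A → h A ≤ A.dom.ncard + c

namespace IsHarmonicSize

variable {h : Assembly Γ.Glue → ℝ≥0}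

theorem tendsto_expectAt (H : Γ.IsHarmonicSize P h) (hP : ∀ t ∈ Γ.tiles, 0 < P t) :
    Tendsto (fun k => Γ.expectAt P k 1) atTop (nhds 0) ∧
      Tendsto (fun k => Γ.expectAt P k fun A => h A) atTop (nhds 0) := by
  obtain ⟨a, ha⟩ := H.exists_ncard_le
  obtain ⟨c, hc⟩ := H.exists_le_ncard
  have hsteps {k : ℕ} {A : Assembly Γ.Glue} (hA : Γ.Producible A)
      (hk : A.dom.ncard = k + Γ.seed.dom.ncard) : (k : ℝ≥0∞) ≤ a * h A := by
    exact_mod_cast (Nat.cast_le.2 (hk ▸ Nat.le_add_right k _)).trans (ha A hA)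
  refine tendsto_zero_of_linear_growth (a := a) (c := Γ.seed.dom.ncard + c) (by simp) (by simp)
    (by simp [expectAt_zero]) (expectAt_eq_add hP fun A _ => harmonicAt_one P A)
    (expectAt_eq_add hP H.harmonicAt) (fun k => ?_) (fun k => ?_) (fun k => ?_)
  · simp only [← expectAt_const_mul]
    refine expectAt_mono hP fun A hA hk => ?_
    by_cases hT : Γ.Terminal A
    · simpa [onTerminal, hT] using hsteps hA hk
    · simp [onTerminal, hT]
  · rw [← expectAt_const_mul, ← expectAt_const_mul]
    exact expectAt_mono hP fun A hA hk => by simpa using hsteps hA hk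
  · simp only [← expectAt_const_mul]
    refine expectAt_mono hP fun A hA hk => ?_
    have := hc A hA
    rw [hk, Nat.cast_add, add_assoc] at this
    simpa using ENNReal.coe_le_coe.2 this

theorem totalProb_eq_one (H : Γ.IsHarmonicSize P h) (hP : ∀ t ∈ Γ.tiles, 0 < P t) :
    Γ.totalProb P = 1 := by
  have := tsum_eq_of_eq_add_succ (expectAt_eq_add hP fun A _ => harmonicAt_one P A)
    (H.tendsto_expectAt hP).1
  simpa [tsum_expectAt_onTerminal, expectAt_zero, totalProb] using this

theorem tsum_terminal_eq (H : Γ.IsHarmonicSize P h) (hP : ∀ t ∈ Γ.tiles, 0 < P t) :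
    ∑' A : {A // Γ.Terminal A}, h A * Γ.probTerm P A = h Γ.seed := by
  have := tsum_eq_of_eq_add_succ (expectAt_eq_add hP H.harmonicAt) (H.tendsto_expectAt hP).2
  rwa [tsum_expectAt_onTerminal, expectAt_zero] at this

theorem isFinite (H : Γ.IsHarmonicSize P h) (hP : ∀ t ∈ Γ.tiles, 0 < P t) : Γ.IsFinite := by
  intro B hB
  by_contra! hBT
  let g : Assembly Γ.Glue → ℝ≥0∞ := fun A => if Γ.Grows B A then 1 else 0
  have hg (A) (hA : Γ.Producible A) : g A ≤ ∑' A', Γ.trans P A A' * g A' := by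
    by_cases hBA : Γ.Grows B A
    · have hT : ¬ Γ.Terminal A := fun hT => hBT A hT hBA
      have hsum := (harmonicAt_one P A).eq_onTerminal_add hP hA
      rw [onTerminal, if_neg hT, zero_add] at hsum
      rw [show g A = 1 from if_pos hBA, ← Pi.one_apply (M := fun _ => ℝ≥0∞) A, hsum]
      refine ENNReal.tsum_le_tsum fun A' => ?_
      by_cases h0 : Γ.trans P A A' = 0
      · simp [h0]
      · have hBA' : Γ.Grows B A' := hBA.tail ((hA.trans_ne_zero_iff hP).1 h0)
        simp [g, hBA']
    · simp [g, hBA]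
  have hmono : Monotone fun k => Γ.expectAt P k g := monotone_nat_of_le_succ fun k => by
    rw [expectAt_succ]
    exact expectAt_mono hP fun A hA _ => hg A hA
  obtain ⟨k, hk⟩ := hB.exists_probAt_ne_zero hP
  have hpos : Γ.probAt P k B ≤ Γ.expectAt P k g :=
    le_trans (by simp [g, show Γ.Grows B B from .refl]) (ENNReal.le_tsum B)
  refine hk (le_zero_iff.1 (ge_of_tendsto (H.tendsto_expectAt hP).1 ?_))
  filter_upwards [eventually_ge_atTop k] with n hn
  refine (hpos.trans (hmono hn)).trans (expectAt_mono hP fun A _ _ => ?_)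
  by_cases hBA : Γ.Grows B A <;> simp [g, hBA]

end IsHarmonicSize

end TileSystem

/-- The edges of the tiles of a block. A block is entered through the edge `entry` of its first
tile and left through the edge `exit true` or `exit false` of its last one; `strong` and `weak`
edges hold the block together. -/
inductive Edge
  | null
  | entry
  | exit (loop : Bool)
  | strong (g : ℕ)
  | weak (g : ℕ)
  deriving DecidableEq

namespace Edge

/-- The strength of the glue on an edge. -/
def strength : Edge → ℕ
  | null => 0
  | weak _ => 1
  | _ => 2

/-- The edges that connect a block to its neighbours. -/
def isPort : Edge → Bool
  | entry => true
  | exit _ => true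
  | _ => false

/-- The glue on the east side of the coin that may happen to agree with the glue of a tile of the
block on its right. -/
def seam : Edge := weak 6

end Edge

/-- A state of the growth of a block: the tiles placed so far, by position and number; the
available attachments, each with the number of the state that it leads to; and the exit taken, if
the growth has decided about it. -/
structure BlockState where
  placed : List ((ℤ × ℤ) × ℕ)
  moves : List (((ℤ × ℤ) × ℕ) × ℕ)
  exit : Option Bool

namespace BlockState

/-- The number of the tile at a position. -/
def look (s : BlockState) (p : ℤ × ℤ) : Option ℕ := s.placed.lookup p

end BlockState

/-- A rectangular component of four rows: its number of columns, the edges (north, east, south,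
west) of its tile types, the states of its growth from the single tile `0` at the origin, and the
probability that the growth leads from a given state to the exit `true`, as a function of the
concentrations of its tile types. -/
structure Block where
  cols : ℕ
  tiles : List (Edge × Edge × Edge × Edge)
  states : List BlockState
  loopProb : (ℕ → ℝ≥0) → ℕ → ℝ≥0

namespace Block

/-- The edge of the tile number `t` in direction `d`. -/
def edge (b : Block) (t : ℕ) (d : Dir) : Edge :=
  let e := b.tiles.getD t (.null, .null, .null, .null)
  match d with
  | .north => e.1
  | .east => e.2.1
  | .south => e.2.2.1
  | .west => e.2.2.2

/-- The state number `c`. -/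
def state (b : Block) (c : ℕ) : BlockState := b.states.getD c ⟨[], [], none⟩

/-- The positions of the tiles of a block. -/
def box (b : Block) : Finset (ℤ × ℤ) := Finset.Ico 0 (b.cols : ℤ) ×ˢ Finset.Ico 0 4

/-- The strength with which the tile number `t` is bound across its edge `d` to the content of the
neighbouring position of the same block. -/
def touch (b : Block) (t : ℕ) (d : Dir) : Option ℕ → ℕ
  | some u => if b.edge t d = b.edge u d.opp then (b.edge t d).strength else 0
  | none => 0

/-- The total strength with which the tile number `t` at the position `p` would be bound to the
other tiles of the block. -/
def binding (b : Block) (s : BlockState) (p : ℤ × ℤ) (t : ℕ) : ℕ :=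
  ∑ d : Dir, b.touch t d (s.look (p + d.vec))

/-- The constraints on the edges of the tile number `t` placed at `p`: towards the outside of the
block it shows only the ports, glues on the south that are too weak to bind a tile on their own, and
on the east side the glue `seam`. -/
structure WellPlaced (b : Block) (s : BlockState) (p : ℤ × ℤ) (t : ℕ) : Prop where
  mem_box : p ∈ b.box
  lt_length : t < b.tiles.length
  inner : ∀ d : Dir, p + d.vec ∈ b.box → (b.edge t d).isPort = false
  north : p.2 = 3 → b.edge t .north = .null
  south : p.2 = 0 → (b.edge t .south).strength ≤ 1
  west : p.1 = 0 → b.edge t .west = if p.2 = 0 then .entry else .null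
  east : p.1 = b.cols - 1 → p.2 ≠ 0 → b.edge t .east = .null ∨ b.edge t .east = .seam
  exit : p.1 = b.cols - 1 → p.2 = 0 → s.exit.map .exit = some (b.edge t .east)

/-- The table of states describes the growth of the block at temperature `2`. -/
structure IsGrowth (b : Block) : Prop where
  wellPlaced : ∀ s ∈ b.states, ∀ a ∈ s.placed, b.WellPlaced s a.1 a.2
  origin : ∀ s ∈ b.states, (s.look (0, 0)).isSome
  row : ∀ s ∈ b.states, s.exit ≠ none → ∀ x ∈ Finset.Ico 0 (b.cols : ℤ), (s.look (x, 0)).isSome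
  two_le_binding_iff : ∀ s ∈ b.states, ∀ p ∈ b.box, s.look p = none →
    ∀ t < b.tiles.length, 2 ≤ b.binding s p t ↔ (p, t) ∈ s.moves.map Prod.fst
  binding_seam : ∀ s ∈ b.states, ∀ y ∈ Finset.Ico (0 : ℤ) 4, ∀ t < b.tiles.length,
    b.edge t .west = .seam → b.binding s (0, y) t = 0
  move : ∀ s ∈ b.states, ∀ m ∈ s.moves, m.1.1 ∈ b.box ∧ s.look m.1.1 = none ∧
    m.1.2 < b.tiles.length ∧ m.2 < b.states.length
  look_move : ∀ s ∈ b.states, ∀ m ∈ s.moves, ∀ p ∈ b.box,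
    (b.state m.2).look p = if p = m.1.1 then some m.1.2 else s.look p
  exit_move : ∀ s ∈ b.states, ∀ m ∈ s.moves, s.exit ≠ none → (b.state m.2).exit = s.exit
  nodup_moves : ∀ s ∈ b.states, (s.moves.map Prod.fst).Nodup
  full : ∀ s ∈ b.states, s.moves = [] → s.exit ≠ none ∧ ∀ p ∈ b.box, (s.look p).isSome
  state_injective : ∀ c < b.states.length, ∀ c' < b.states.length,
    (∀ p ∈ b.box, (b.state c).look p = (b.state c').look p) → c = c'
  start : 0 < b.states.length ∧ (b.state 0).placed = [((0, 0), 0)]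
  tile_injective : ∀ t < b.tiles.length, ∀ u < b.tiles.length,
    (∀ d, b.edge t d = b.edge u d ∨ (b.edge t d).isPort ∧ (b.edge u d).isPort) → t = u
  west_ne_exit : ∀ t < b.tiles.length, ∀ r, b.edge t .west ≠ .exit r
  east_ne_entry : ∀ t < b.tiles.length, b.edge t .east ≠ .entry
  west_eq_entry_iff : ∀ t < b.tiles.length, b.edge t .west = .entry ↔ t = 0

theorem IsGrowth.wellPlaced_start {b : Block} (hb : b.IsGrowth) :
    b.WellPlaced (b.state 0) (0, 0) 0 := by
  refine hb.wellPlaced _ ?_ ((0, 0), 0) (by simp [hb.start.2])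
  rw [state, List.getD_eq_getElem _ _ hb.start.1]
  exact List.getElem_mem _

open Edge in
/-- A single column of four tiles, left through the exit `false`. -/
def column : Block where
  cols := 1
  tiles := [(strong 10, exit false, null, entry), (strong 11, null, strong 10, null),
    (strong 12, null, strong 11, null), (null, null, strong 12, null)]
  states :=
    [⟨[((0, 0), 0)], [(((0, 1), 1), 1)], some false⟩,
      ⟨[((0, 0), 0), ((0, 1), 1)], [(((0, 2), 2), 2)], some false⟩,
      ⟨[((0, 0), 0), ((0, 1), 1), ((0, 2), 2)], [(((0, 3), 3), 3)], some false⟩,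
      ⟨[((0, 0), 0), ((0, 1), 1), ((0, 2), 2), ((0, 3), 3)], [], some false⟩]
  loopProb _ _ := 0

instance (b : Block) (s : BlockState) (p : ℤ × ℤ) (t : ℕ) : Decidable (b.WellPlaced s p t) :=
  decidable_of_iff (p ∈ b.box ∧ t < b.tiles.length ∧
    (∀ d : Dir, p + d.vec ∈ b.box → (b.edge t d).isPort = false) ∧
    (p.2 = 3 → b.edge t .north = .null) ∧
    (p.2 = 0 → (b.edge t .south).strength ≤ 1) ∧
    (p.1 = 0 → b.edge t .west = if p.2 = 0 then .entry else .null) ∧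
    (p.1 = b.cols - 1 → p.2 ≠ 0 → b.edge t .east = .null ∨ b.edge t .east = .seam) ∧
    (p.1 = b.cols - 1 → p.2 = 0 → s.exit.map .exit = some (b.edge t .east)))
    ⟨fun ⟨h₁, h₂, h₃, h₄, h₅, h₆, h₇, h₈⟩ => ⟨h₁, h₂, h₃, h₄, h₅, h₆, h₇, h₈⟩,
      fun ⟨h₁, h₂, h₃, h₄, h₅, h₆, h₇, h₈⟩ => ⟨h₁, h₂, h₃, h₄, h₅, h₆, h₇, h₈⟩⟩

theorem isGrowth_column : column.IsGrowth := by
  constructor <;> decide +kernel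

/-- The tiles of the coin that attach one after the other in a fixed order. -/
def frame : List ((ℤ × ℤ) × ℕ) :=
  [(0, 0), (0, 1), (0, 2), (0, 3), (1, 3), (2, 3), (3, 3), (4, 3), (4, 2), (3, 2), (2, 2), (1, 2),
    (1, 1), (1, 0), (2, 0)].zipIdx

/-- The states of the coin once its frame is complete, without the tiles of the frame. -/
def race : List BlockState :=
  [⟨[], [(((2, 1), 15), 15), (((3, 0), 16), 16)], none⟩,
    ⟨[((2, 1), 15)], [(((3, 0), 16), 17), (((3, 1), 16), 18)], none⟩,
    ⟨[((3, 0), 16)], [(((2, 1), 15), 17), (((3, 1), 15), 23)], none⟩,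
    ⟨[((2, 1), 15), ((3, 0), 16)], [(((3, 1), 16), 19), (((3, 1), 15), 24)], none⟩,
    ⟨[((2, 1), 15), ((3, 1), 16)], [(((3, 0), 16), 19), (((4, 1), 17), 20)], none⟩,
    ⟨[((2, 1), 15), ((3, 0), 16), ((3, 1), 16)], [(((4, 1), 17), 21)], none⟩,
    ⟨[((2, 1), 15), ((3, 1), 16), ((4, 1), 17)], [(((3, 0), 16), 21)], none⟩,
    ⟨[((2, 1), 15), ((3, 0), 16), ((3, 1), 16), ((4, 1), 17)], [(((4, 0), 19), 22)], none⟩,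
    ⟨[((2, 1), 15), ((3, 0), 16), ((3, 1), 16), ((4, 1), 17), ((4, 0), 19)], [], some true⟩,
    ⟨[((3, 0), 16), ((3, 1), 15)], [(((2, 1), 15), 24), (((4, 1), 16), 25)], none⟩,
    ⟨[((2, 1), 15), ((3, 0), 16), ((3, 1), 15)], [(((4, 1), 16), 26)], none⟩,
    ⟨[((3, 0), 16), ((3, 1), 15), ((4, 1), 16)],
      [(((2, 1), 15), 26), (((4, 0), 18), 27)], none⟩,
    ⟨[((2, 1), 15), ((3, 0), 16), ((3, 1), 15), ((4, 1), 16)], [(((4, 0), 18), 28)], none⟩,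
    ⟨[((3, 0), 16), ((3, 1), 15), ((4, 1), 16), ((4, 0), 18)],
      [(((2, 1), 15), 28)], some false⟩,
    ⟨[((2, 1), 15), ((3, 0), 16), ((3, 1), 15), ((4, 1), 16), ((4, 0), 18)], [], some false⟩]

open Edge in
/-- A block of five columns that is left through each of the two exits with probability one half.
Next to the frame the position `(3, 1)` can be reached in two ways, through the tile `15` followed
by the tile `16` or through the tile `16` followed by the tile `15`, and the first arrival decides
about the exit. Both ways need one tile of each of the two types, so they are equally fast in
distribution whatever the concentrations. -/
def coin : Block where
  cols := 5
  tiles := [(strong 10, null, null, entry),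
    (strong 11, null, strong 10, null),
    (strong 12, null, strong 11, null),
    (null, strong 13, strong 12, null),
    (null, strong 14, null, strong 13),
    (null, strong 15, null, strong 14),
    (null, strong 16, null, strong 15),
    (null, null, strong 17, strong 16),
    (strong 17, null, weak 9, strong 18),
    (null, strong 18, null, strong 19),
    (null, strong 19, null, strong 20),
    (null, strong 20, strong 21, null),
    (strong 21, null, strong 22, null),
    (strong 22, strong 23, null, null),
    (strong 4, strong 5, null, strong 23),
    (null, strong 5, strong 4, null),
    (strong 4, weak 6, weak 7, strong 5),
    (weak 9, null, weak 8, weak 6),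
    (weak 7, exit false, null, weak 6),
    (weak 8, exit true, null, weak 6)]
  states :=
    (List.range 14).map (fun k => ⟨frame.take (k + 1), [(frame.getD (k + 1) 0, k + 1)], none⟩) ++
      race.map fun s => { s with placed := frame ++ s.placed }
  loopProb w c :=
    if c < 15 then 1 / 2
    else if c = 15 then (w 15 + 2 * w 16) / (2 * (w 15 + w 16))
    else if c = 16 then w 16 / (2 * (w 15 + w 16))
    else if c = 17 then w 16 / (w 15 + w 16)
    else if c < 23 then 1 else 0

theorem isGrowth_coin : coin.IsGrowth := by
  constructor <;> decide +kernel

/-- The function `loopProb` is the probability of the exit `true`, for every choice of positive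
concentrations. -/
structure HasLoopProb (b : Block) : Prop where
  harmonic : ∀ w : ℕ → ℝ≥0, (∀ t < b.tiles.length, 0 < w t) → ∀ c < b.states.length,
    ((b.state c).moves.map fun m => w m.1.2 * b.loopProb w m.2).sum =
      ((b.state c).moves.map fun m => w m.1.2).sum * b.loopProb w c
  exit : ∀ w, ∀ c < b.states.length, ∀ r, (b.state c).exit = some r →
    b.loopProb w c = if r then 1 else 0
  le_one : ∀ w c, b.loopProb w c ≤ 1

theorem hasLoopProb_column : column.HasLoopProb where
  harmonic _ _ _ _ := by simp [column]
  exit _ c hc r hr := by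
    have : ∀ c < column.states.length, ∀ r, (column.state c).exit = some r → r = false := by
      decide +kernel
    rw [this c hc r hr]
    rfl
  le_one _ _ := zero_le_one

theorem coin_exit (c : ℕ) (hc : c < coin.states.length) (r : Bool)
    (h : (coin.state c).exit = some r) : if r then c = 22 else 23 ≤ c := by
  revert c r
  decide +kernel

theorem hasLoopProb_coin : coin.HasLoopProb where
  harmonic w hw c hc := by
    have hu : w 15 ≠ 0 := (hw 15 (by decide)).ne'
    have hv : w 16 ≠ 0 := (hw 16 (by decide)).ne'
    have hc' : c < 29 := hc
    interval_cases c <;> simp [state, coin, race, frame] <;> field_simp <;> ring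
  exit w c hc r hr := by
    have := coin_exit c hc r hr
    cases r
    · have : 23 ≤ c := by simpa using this
      simp [coin, show ¬ c < 15 by lia, show ¬ c < 23 by lia, show c ≠ 15 by lia,
        show c ≠ 16 by lia, show c ≠ 17 by lia]
    · have heq : c = 22 := by simpa using this
      simp [coin, heq]
  le_one _ _ := by
    simp only [coin]
    split_ifs
    · norm_num
    · refine div_le_one_of_le₀ ?_ zero_le
      rw [mul_add]
      gcongr
      exact le_mul_of_one_le_left zero_le one_le_two
    · refine div_le_one_of_le₀ (le_trans ?_ (le_mul_of_one_le_left zero_le one_le_two)) zero_le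
      exact le_add_self
    · exact div_le_one_of_le₀ le_add_self zero_le
    · exact le_rfl
    · exact zero_le_one

end Block

/-- The glues of the line: `entrance i` is shared by the entry of the block with label `i` and the
exits that lead to it, the other glues belong to the inside of the block with label `i`. -/
inductive Glue
  | null
  | entrance (i : ℕ)
  | strong (i g : ℕ)
  | weak (i g : ℕ)

/-- The strength of a glue. -/
def Glue.strength : Glue → ℕ
  | null => 0
  | weak _ _ => 1
  | _ => 2

/-- A counter that starts at `top + 1`: its value `i` is represented by a copy of the block
`block i`, whose exit `false` decreases it to `i - 1` and whose exit `true` resets it to `top`. -/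
structure Counter where
  top : ℕ
  block : ℕ → Block
  isGrowth : ∀ i, (block i).IsGrowth
  hasLoopProb : ∀ i, (block i).HasLoopProb

namespace Counter

variable {M : Counter} {c i j t u : ℕ} {l l' : List ℕ} {p q : ℤ × ℤ} {a : Tile Glue}

/-- The value of the counter after the block with label `i` is left through an exit; the value `0`
stands for the end of the line, or for a block that is still growing. -/
def target (M : Counter) (i : ℕ) : Option Bool → ℕ
  | some true => M.top
  | some false => i - 1
  | none => 0

/-- The glue of an edge of the block with label `i`. -/
def glue (M : Counter) (i : ℕ) : Edge → Glue
  | .null => .null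
  | .entry => .entrance i
  | .exit r => .entrance (M.target i (some r))
  | .strong g => .strong i g
  | .weak g => .weak i g

/-- The tile type number `t` of the block with label `i`. -/
def tile (M : Counter) (i t : ℕ) : Tile Glue where
  glue d := M.glue i ((M.block i).edge t d)
  label := default

theorem strength_glue (M : Counter) (i : ℕ) (e : Edge) : (M.glue i e).strength = e.strength := by
  cases e <;> rfl

theorem glue_eq_glue_iff {e e' : Edge} (h : e'.isPort = false) :
    M.glue i e = M.glue i e' ↔ e = e' := by
  cases e' <;> cases e <;> simp_all [glue, Edge.isPort]

theorem strength_eq_zero_of_glue_eq {e e' : Edge} (hij : i ≠ j) (h : e'.isPort = false)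
    (hg : M.glue i e = M.glue j e') : e.strength = 0 := by
  cases e' <;> cases e <;> simp_all [glue, Edge.isPort, Edge.strength]

theorem tile_injOn (M : Counter) (i : ℕ) :
    Set.InjOn (M.tile i) {t | t < (M.block i).tiles.length} := by
  refine fun t ht u hu h => (M.isGrowth i).tile_injective t ht u hu fun d => ?_
  have hd : M.glue i ((M.block i).edge t d) = M.glue i ((M.block i).edge u d) :=
    congrFun (congrArg Tile.glue h) d
  cases ht' : ((M.block i).edge t d).isPort
  · exact .inl ((glue_eq_glue_iff ht').1 hd.symm).symm
  cases hu' : ((M.block i).edge u d).isPort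
  · exact .inl ((glue_eq_glue_iff hu').1 hd)
  · exact .inr ⟨rfl, rfl⟩

theorem touch_le_left {d : Dir} {x : Option (Tile Glue)} :
    (M.tile i t).touch Glue.strength d x ≤ ((M.block i).edge t d).strength := by
  cases x with
  | none => exact Nat.zero_le _
  | some b =>
    rw [Tile.touch]
    split_ifs
    · exact (M.strength_glue ..).le
    · exact Nat.zero_le _

theorem touch_le_right {d : Dir} {b : Tile Glue} :
    b.touch Glue.strength d (some (M.tile i u)) ≤ ((M.block i).edge u d.opp).strength := by
  rw [Tile.touch]
  split_ifs with h
  · rw [h]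
    exact (M.strength_glue ..).le
  · exact Nat.zero_le _

theorem touch_tile {d : Dir} (h : ((M.block i).edge u d.opp).isPort = false) :
    (M.tile j t).touch Glue.strength d (some (M.tile i u)) =
      if j = i then (M.block i).touch t d (some u) else 0 := by
  split_ifs with hij
  · subst hij
    simp only [Tile.touch, tile, glue_eq_glue_iff h, strength_glue, Block.touch]
  · rw [Tile.touch]
    split_ifs with hg
    · exact (M.strength_glue ..).trans (strength_eq_zero_of_glue_eq hij h hg)
    · rfl

/-- The value of the counter after the blocks described by a list of the numbers of their states,
with the latest block at the head. -/
def label (M : Counter) : List ℕ → ℕ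
  | [] => M.top + 1
  | c :: l => M.target (label M l) ((M.block (label M l)).state c).exit

/-- The number of columns of the blocks described by a list of states. -/
def width (M : Counter) : List ℕ → ℕ
  | [] => 0
  | _ :: l => width M l + (M.block (M.label l)).cols

/-- The position of the lower left corner of the block that follows the blocks of `l`. -/
def corner (M : Counter) (l : List ℕ) : ℤ × ℤ := (M.width l, 0)

/-- The assembly formed by the blocks described by a list of states. -/
def assembly (M : Counter) : List ℕ → Assembly Glue
  | [] => fun _ => none
  | c :: l => fun p =>
    if p.1 < M.width l then assembly M l p
    else (((M.block (M.label l)).state c).look (p - M.corner l)).map (M.tile (M.label l))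

/-- The lists of states that describe the growth of the line: a block only starts once the value of
the counter is known and positive. -/
def Valid (M : Counter) : List ℕ → Prop
  | [] => True
  | c :: l => Valid M l ∧ 0 < M.label l ∧ c < (M.block (M.label l)).states.length

theorem state_mem (h : M.Valid (c :: l)) :
    (M.block (M.label l)).state c ∈ (M.block (M.label l)).states := by
  rw [Block.state, List.getD_eq_getElem _ _ h.2.2]
  exact List.getElem_mem _

theorem target_le (hi : i ≤ M.top + 1) (r : Option Bool) : M.target i r ≤ M.top := by
  cases r with
  | none => exact Nat.zero_le _
  | some r => cases r <;> simp only [target] <;> lia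

theorem label_cons_le (M : Counter) : ∀ c l, M.label (c :: l) ≤ M.top
  | _, [] => target_le le_rfl _
  | _, c :: l => target_le ((label_cons_le M c l).trans (Nat.le_succ _)) _

theorem label_le (M : Counter) : ∀ l, M.label l ≤ M.top + 1
  | [] => le_rfl
  | c :: l => (M.label_cons_le c l).trans (Nat.le_succ _)

theorem exit_ne_none (h : 0 < M.label (c :: l)) :
    ((M.block (M.label l)).state c).exit ≠ none := fun h' => by
  rw [label, h'] at h
  exact h.ne rfl

theorem cols_pos (M : Counter) (i : ℕ) : 0 < (M.block i).cols := by
  simpa [Block.box] using (M.isGrowth i).wellPlaced_start.mem_box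

theorem length_tiles_pos (M : Counter) (i : ℕ) : 0 < (M.block i).tiles.length :=
  (M.isGrowth i).wellPlaced_start.lt_length

theorem wellPlaced_of_look (h : M.Valid (c :: l))
    (hu : ((M.block (M.label l)).state c).look q = some u) :
    (M.block (M.label l)).WellPlaced ((M.block (M.label l)).state c) q u := by
  obtain ⟨l₁, l₂, hl, -⟩ := List.lookup_eq_some_iff.1 hu
  exact (M.isGrowth _).wellPlaced _ (state_mem h) (q, u) (by simp [hl])

theorem sub_corner_mem_box :
    p - M.corner l ∈ (M.block (M.label l)).box ↔
      ((M.width l : ℤ) ≤ p.1 ∧ p.1 < M.width (c :: l)) ∧ p.2 ∈ Finset.Ico 0 4 := by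
  simp only [Block.box, corner, width, Finset.mem_product, Finset.mem_Ico, Prod.fst_sub,
    Prod.snd_sub]
  lia

theorem assembly_cons_of_lt (h : p.1 < M.width l) :
    M.assembly (c :: l) p = M.assembly l p := if_pos h

theorem assembly_cons_of_le (h : M.width l ≤ p.1) :
    M.assembly (c :: l) p =
      (((M.block (M.label l)).state c).look (p - M.corner l)).map (M.tile (M.label l)) :=
  if_neg h.not_gt

theorem assembly_append_of_lt (h : p.1 < M.width l) :
    ∀ l', M.assembly (l' ++ l) p = M.assembly l p ∧ p.1 < M.width (l' ++ l)
  | [] => ⟨rfl, h⟩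
  | c :: l' => by
    obtain ⟨h₁, h₂⟩ := assembly_append_of_lt h l'
    refine ⟨(assembly_cons_of_lt h₂).trans h₁, h₂.trans_le ?_⟩
    exact_mod_cast Nat.le_add_right _ _

theorem exists_look_of_assembly (hp : M.width l ≤ p.1) (ha : M.assembly (c :: l) p = some a) :
    ∃ u, ((M.block (M.label l)).state c).look (p - M.corner l) = some u ∧
      a = M.tile (M.label l) u := by
  rw [assembly_cons_of_le hp, Option.map_eq_some_iff] at ha
  obtain ⟨u, hu, rfl⟩ := ha
  exact ⟨u, hu, rfl⟩

theorem exists_tile_of_assembly (hl : M.Valid l) (ha : M.assembly l p = some a) :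
    ∃ c l' u, M.Valid (c :: l') ∧ (c :: l') <:+ l ∧ a = M.tile (M.label l') u ∧
      (M.block (M.label l')).WellPlaced ((M.block (M.label l')).state c) (p - M.corner l') u := by
  induction l with
  | nil => exact absurd ha (Option.some_ne_none a).symm
  | cons c l ih =>
    rcases lt_or_ge p.1 (M.width l : ℤ) with h | h
    · rw [assembly_cons_of_lt h] at ha
      obtain ⟨c', l', u, hl', hsuf, hu⟩ := ih hl.1 ha
      exact ⟨c', l', u, hl', hsuf.trans (List.suffix_cons c l), hu⟩
    · obtain ⟨u, hu, rfl⟩ := exists_look_of_assembly h ha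
      exact ⟨c, l, u, hl, List.suffix_rfl, rfl, wellPlaced_of_look hl hu⟩

theorem width_le_of_suffix (h : l' <:+ l) : M.width l' ≤ M.width l := by
  obtain ⟨l'', rfl⟩ := h
  induction l'' with
  | nil => exact le_rfl
  | cons c l'' ih => exact ih.trans (Nat.le_add_right _ _)

theorem dom_assembly_subset (hl : M.Valid l) :
    (M.assembly l).dom ⊆ Set.Ico (0 : ℤ) (M.width l) ×ˢ Set.Ico (0 : ℤ) 4 := by
  intro p hp
  obtain ⟨a, ha⟩ := Option.ne_none_iff_exists'.1 hp
  obtain ⟨c, l', u, -, hsuf, -, hu⟩ := exists_tile_of_assembly hl ha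
  obtain ⟨⟨h₁, h₂⟩, h₃⟩ := (sub_corner_mem_box (c := c)).1 hu.mem_box
  have := width_le_of_suffix (M := M) hsuf
  exact ⟨⟨by lia, by lia⟩, by simpa using h₃⟩

theorem assembly_eq_none (hl : M.Valid l)
    (hp : p ∉ Set.Ico (0 : ℤ) (M.width l) ×ˢ Set.Ico (0 : ℤ) 4) : M.assembly l p = none :=
  not_not.1 fun h => hp (dom_assembly_subset hl h)

theorem look_eq_none (hl : M.Valid (c :: l)) (hq : q ∉ (M.block (M.label l)).box) :
    ((M.block (M.label l)).state c).look q = none :=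
  Option.eq_none_iff_forall_ne_some.2 fun _ hu => hq (wellPlaced_of_look hl hu).mem_box

theorem assembly_cons_row_ne_none (hl : M.Valid (c :: l)) {x : ℤ} (h₁ : M.width l ≤ x)
    (h₂ : x < M.width (c :: l)) (h : x = M.width l ∨ 0 < M.label (c :: l)) :
    M.assembly (c :: l) (x, 0) ≠ none := by
  rw [assembly_cons_of_le h₁, ne_eq, Option.map_eq_none_iff, ← ne_eq, Option.ne_none_iff_isSome]
  have hbox : ((x, 0) : ℤ × ℤ) - M.corner l = (x - M.width l, 0) := by simp [corner]
  rw [hbox]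
  rcases h with rfl | h
  · simpa using (M.isGrowth _).origin _ (state_mem hl)
  · refine (M.isGrowth _).row _ (state_mem hl) (exit_ne_none h) _ ?_
    rw [width] at h₂
    rw [Finset.mem_Ico]
    lia

theorem assembly_row_ne_none (hl : M.Valid l) (h : 0 < M.label l) {x : ℤ} (h₁ : 0 ≤ x)
    (h₂ : x < M.width l) : M.assembly l (x, 0) ≠ none := by
  induction l with
  | nil => exact absurd h₂ h₁.not_gt
  | cons c l ih =>
    rcases lt_or_ge x (M.width l : ℤ) with hx | hx
    · rw [assembly_cons_of_lt hx]
      exact ih hl.1 hl.2.1 hx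
    · exact assembly_cons_row_ne_none hl hx h₂ (.inr h)

theorem touch_assembly_cons (hl : M.Valid (c :: l)) {d : Dir}
    (hp : p - M.corner l ∈ (M.block (M.label l)).box) (hd : M.width l ≤ (p + d.vec).1) :
    (M.tile j t).touch Glue.strength d (M.assembly (c :: l) (p + d.vec)) =
      if j = M.label l then (M.block (M.label l)).touch t d
        (((M.block (M.label l)).state c).look (p - M.corner l + d.vec)) else 0 := by
  rw [assembly_cons_of_le hd, add_sub_right_comm]
  cases hu : ((M.block (M.label l)).state c).look (p - M.corner l + d.vec) with
  | none => exact (ite_self 0).symm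
  | some u =>
    refine touch_tile ((wellPlaced_of_look hl hu).inner d.opp ?_)
    rwa [Dir.vec_opp, add_neg_cancel_right]

theorem binding_assembly_cons (hl : M.Valid (c :: l))
    (hp : p - M.corner l ∈ (M.block (M.label l)).box) :
    (M.assembly (c :: l)).binding Glue.strength p (M.tile j t) =
      (if j = M.label l then
        (M.block (M.label l)).binding ((M.block (M.label l)).state c) (p - M.corner l) t else 0) +
      if p.1 = M.width l then
        (M.tile j t).touch Glue.strength .west (M.assembly l (p + Dir.west.vec)) else 0 := by
  have hle : (M.width l : ℤ) ≤ p.1 := (sub_corner_mem_box (c := c).1 hp).1.1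
  have hterm (d : Dir) : (M.tile j t).touch Glue.strength d (M.assembly (c :: l) (p + d.vec)) =
      (if j = M.label l then (M.block (M.label l)).touch t d
        (((M.block (M.label l)).state c).look (p - M.corner l + d.vec)) else 0) +
      if d = .west then if p.1 = M.width l then
        (M.tile j t).touch Glue.strength d (M.assembly l (p + d.vec)) else 0 else 0 := by
    by_cases hd : M.width l ≤ (p + d.vec).1
    · rw [touch_assembly_cons hl hp hd, left_eq_add]
      refine ite_eq_right_iff.2 ?_
      rintro rfl
      exact if_neg fun h => by simp [Dir.vec, h] at hd
    · have hd' : d = .west ∧ p.1 = M.width l := by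
        cases d <;> simp [Dir.vec] at hd <;> simp <;> lia
      have hout : ((M.block (M.label l)).state c).look (p - M.corner l + d.vec) = none := by
        refine look_eq_none hl fun h => hd ?_
        rw [← add_sub_right_comm] at h
        exact (sub_corner_mem_box (c := c).1 h).1.1
      rw [if_pos hd'.1, if_pos hd'.2, hout, assembly_cons_of_lt (not_le.1 hd)]
      simp [Block.touch]
  simp only [Assembly.binding, Block.binding, hterm, Finset.sum_add_distrib, Finset.sum_ite_eq',
    Finset.mem_univ, if_true]
  split_ifs <;> simp

theorem touch_west_eq_zero_or (hl : M.Valid l) (hp : p.1 = M.width l) (hp' : p.2 ≠ 0) :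
    (M.tile j t).touch Glue.strength .west (M.assembly l (p + Dir.west.vec)) = 0 ∨
      (M.block j).edge t .west = .seam := by
  cases ha : M.assembly l (p + Dir.west.vec) with
  | none => exact .inl rfl
  | some a =>
    cases l with
    | nil => exact absurd ha (Option.some_ne_none a).symm
    | cons c l =>
      have hcols := M.cols_pos (M.label l)
      rw [width, Nat.cast_add] at hp
      have hle : (M.width l : ℤ) ≤ (p + Dir.west.vec).1 := by simp [Dir.vec]; lia
      obtain ⟨u, hu, rfl⟩ := exists_look_of_assembly hle ha
      have hu := wellPlaced_of_look hl hu
      rcases hu.east (by simp [corner, Dir.vec]; lia) (by simpa [corner, Dir.vec]) with h | h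
      · refine .inl (Nat.le_zero.1 (touch_le_right.trans ?_))
        rw [Dir.opp, h]
        rfl
      · rw [touch_tile (by rw [Dir.opp, h]; rfl), Block.touch, Dir.opp, h]
        by_cases hj : j = M.label l
        · subst hj
          by_cases hs : (M.block (M.label l)).edge t .west = .seam
          · exact .inr hs
          · simp [hs]
        · simp [hj]

theorem two_le_binding_iff_of_mem_box (hl : M.Valid (c :: l))
    (hp : p - M.corner l ∈ (M.block (M.label l)).box) (hnone : M.assembly (c :: l) p = none)
    (ht : t < (M.block j).tiles.length) :
    2 ≤ (M.assembly (c :: l)).binding Glue.strength p (M.tile j t) ↔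
      j = M.label l ∧
        (p - M.corner l, t) ∈ ((M.block (M.label l)).state c).moves.map Prod.fst := by
  obtain ⟨⟨hle, hlt⟩, hy⟩ := sub_corner_mem_box (c := c).1 hp
  have hlook : ((M.block (M.label l)).state c).look (p - M.corner l) = none := by
    rwa [assembly_cons_of_le hle, Option.map_eq_none_iff] at hnone
  have hlocal (hj : j = M.label l) := (M.isGrowth (M.label l)).two_le_binding_iff _ (state_mem hl)
    _ hp hlook t (hj ▸ ht)
  rw [binding_assembly_cons hl hp]
  by_cases hx : p.1 = M.width l
  · have hy0 : p.2 ≠ 0 := fun h => assembly_cons_row_ne_none hl hle hlt (.inl hx) (h ▸ hnone)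
    rw [if_pos hx]
    rcases touch_west_eq_zero_or (t := t) (j := j) hl.1 hx hy0 with h | h
    · rw [h, add_zero]
      by_cases hj : j = M.label l <;> simp [hj, hlocal]
    · have hle_one : (M.tile j t).touch Glue.strength .west (M.assembly l (p + Dir.west.vec)) ≤ 1 :=
        touch_le_left.trans (by rw [h]; rfl)
      have hzero (hj : j = M.label l) : (M.block (M.label l)).binding
          ((M.block (M.label l)).state c) (p - M.corner l) t = 0 := by
        have := (M.isGrowth _).binding_seam _ (state_mem hl) p.2 hy t (hj ▸ ht) (hj ▸ h)
        rwa [show p - M.corner l = (0, p.2) by ext <;> simp [corner, hx]]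
      have hmove (hj : j = M.label l) := (hlocal hj).not.1 (by rw [hzero hj]; lia)
      refine iff_of_false ?_ fun h => hmove h.1 h.2
      split_ifs with hj
      · rw [hzero hj]
        lia
      · lia
  · rw [if_neg hx, add_zero]
    by_cases hj : j = M.label l <;> simp [hj, hlocal]

theorem binding_assembly_cons_of_lt (hl : M.Valid (c :: l)) (hp : 0 ≤ p.1) (hp' : p.1 < M.width l)
    (hnone : M.assembly l p = none) :
    (M.assembly (c :: l)).binding Glue.strength p (M.tile j t) =
      (M.assembly l).binding Glue.strength p (M.tile j t) := by
  refine Finset.sum_congr rfl fun d _ => ?_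
  rcases lt_or_ge (p + d.vec).1 (M.width l : ℤ) with hd | hd
  · rw [assembly_cons_of_lt hd]
  · have hd' : d = .east ∧ p.1 + 1 = M.width l := by
      cases d <;> simp [Dir.vec] at hd <;> simp <;> lia
    have hy : p.2 ≠ 0 := fun h => assembly_row_ne_none hl.1 hl.2.1 hp hp' (h ▸ hnone)
    rw [assembly_eq_none hl.1 fun h => hd.not_gt h.1.2]
    cases ha : M.assembly (c :: l) (p + d.vec) with
    | none => rfl
    | some a =>
      obtain ⟨u, hu, rfl⟩ := exists_look_of_assembly hd ha
      have hwest := (wellPlaced_of_look hl hu).west (by simp [hd'.1, corner, Dir.vec]; lia)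
      rw [if_neg (by simpa [hd'.1, corner, Dir.vec])] at hwest
      refine Nat.le_zero.1 (touch_le_right.trans ?_)
      rw [hd'.1, Dir.opp, hwest]
      rfl

theorem binding_le_one_of_snd_notMem (hl : M.Valid l) (hp : p.2 ∉ Set.Ico (0 : ℤ) 4)
    (b : Tile Glue) : (M.assembly l).binding Glue.strength p b ≤ 1 := by
  have hterm (d : Dir) : b.touch Glue.strength d (M.assembly l (p + d.vec)) ≤
      if d = .north then 1 else 0 := by
    cases ha : M.assembly l (p + d.vec) with
    | none => exact Nat.zero_le _
    | some a =>
      obtain ⟨c', l', u, -, -, rfl, hu⟩ := exists_tile_of_assembly hl ha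
      have hy := (sub_corner_mem_box (c := c').1 hu.mem_box).2
      refine touch_le_right.trans ?_
      cases d
      · exact hu.south (by simp [corner, Dir.vec] at hy hp ⊢; lia)
      · exact absurd (by simpa [Dir.vec] using hy) hp
      · rw [show (Dir.south : Dir).opp = .north from rfl,
          hu.north (by simp [corner, Dir.vec] at hy hp ⊢; lia)]
        rfl
      · exact absurd (by simpa [Dir.vec] using hy) hp
  exact (Finset.sum_le_sum fun d _ => hterm d).trans (by simp)

theorem glue_tile (M : Counter) (i t : ℕ) (d : Dir) :
    (M.tile i t).glue d = M.glue i ((M.block i).edge t d) := rfl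

theorem glue_east_ne_entrance (hi : i ≤ M.top + 1) (ht : t < (M.block i).tiles.length) :
    (M.tile i t).glue .east ≠ .entrance (M.top + 1) := by
  rw [glue_tile]
  cases he : (M.block i).edge t .east with
  | entry => exact absurd he ((M.isGrowth i).east_ne_entry t ht)
  | exit r => simpa [glue] using (Nat.lt_succ_of_le (target_le hi (some r))).ne
  | _ => exact Glue.noConfusion

theorem binding_eq_zero_of_fst_neg (hl : M.Valid l) (hp : p.1 < 0) (hj : j ≤ M.top + 1)
    (ht : t < (M.block j).tiles.length) :
    (M.assembly l).binding Glue.strength p (M.tile j t) = 0 := by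
  refine Finset.sum_eq_zero fun d _ => ?_
  cases ha : M.assembly l (p + d.vec) with
  | none => rfl
  | some a =>
    have hx := (dom_assembly_subset hl (ha.trans_ne (Option.some_ne_none a))).1.1
    obtain ⟨rfl, hx'⟩ : d = .east ∧ p.1 + 1 = 0 := by
      cases d <;> simp [Dir.vec] at hx <;> simp <;> lia
    obtain ⟨c', l', u, -, -, rfl, hu⟩ := exists_tile_of_assembly hl ha
    have hwidth : M.width l' = 0 := by
      simpa [Dir.vec, hx'] using (sub_corner_mem_box (c := c').1 hu.mem_box).1.1
    obtain rfl : l' = [] := by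
      cases l' with
      | nil => rfl
      | cons c l => exact absurd hwidth (Nat.add_pos_right _ (M.cols_pos _)).ne'
    have hwest := hu.west (by simp [corner, Dir.vec, hx', width])
    by_cases hy : p.2 = 0
    · rw [if_pos (by simp [corner, Dir.vec, hy])] at hwest
      refine if_neg fun h => glue_east_ne_entrance hj ht (h.trans ?_)
      rw [glue_tile, Dir.opp, hwest]
      rfl
    · rw [if_neg (by simpa [corner, Dir.vec])] at hwest
      refine Nat.le_zero.1 (touch_le_right.trans ?_)
      rw [Dir.opp, hwest]
      rfl

theorem glue_west_eq_entrance_iff (ht : t < (M.block j).tiles.length) :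
    (M.tile j t).glue .west = .entrance i ↔ j = i ∧ t = 0 := by
  rw [← (M.isGrowth j).west_eq_entry_iff t ht, glue_tile]
  cases he : (M.block j).edge t .west with
  | exit r => exact absurd he ((M.isGrowth j).west_ne_exit t ht r)
  | _ => simp [glue]

theorem touch_west_corner (hl : M.Valid (c :: l)) (hj : 0 < j)
    (ht : t < (M.block j).tiles.length) :
    (M.tile j t).touch Glue.strength .west
        (M.assembly (c :: l) (M.corner (c :: l) + Dir.west.vec)) =
      if j = M.label (c :: l) ∧ t = 0 then 2 else 0 := by
  have hcols := M.cols_pos (M.label l)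
  have hpos : M.corner (c :: l) + Dir.west.vec = ((M.width (c :: l) : ℤ) - 1, 0) := rfl
  cases ha : M.assembly (c :: l) (M.corner (c :: l) + Dir.west.vec) with
  | none =>
    refine (if_neg fun h => ?_).symm
    refine assembly_cons_row_ne_none hl ?_ (sub_one_lt _) (.inr (h.1 ▸ hj)) (hpos ▸ ha)
    rw [width]
    lia
  | some a =>
    obtain ⟨u, hu, rfl⟩ := exists_look_of_assembly (by simp [hpos, width]; lia) ha
    have hexit := (wellPlaced_of_look hl hu).exit (by simp [Dir.vec, width, corner]; ring) rfl
    obtain ⟨r, hr, hedge⟩ := Option.map_eq_some_iff.1 hexit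
    have hlabel : (M.tile (M.label l) u).glue .east = .entrance (M.label (c :: l)) := by
      rw [glue_tile, ← hedge, glue, label, hr]
    rw [Tile.touch, Dir.opp, hlabel]
    simp only [glue_west_eq_entrance_iff ht]
    split_ifs with h
    · rw [(glue_west_eq_entrance_iff ht).2 h]
      rfl
    · rfl

theorem two_le_binding_iff_of_width_le (hl : M.Valid (c :: l)) (hp : M.width (c :: l) ≤ p.1)
    (hj : 0 < j) (ht : t < (M.block j).tiles.length) :
    2 ≤ (M.assembly (c :: l)).binding Glue.strength p (M.tile j t) ↔
      p = M.corner (c :: l) ∧ j = M.label (c :: l) ∧ t = 0 := by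
  have hbinding : (M.assembly (c :: l)).binding Glue.strength p (M.tile j t) =
      (M.tile j t).touch Glue.strength .west (M.assembly (c :: l) (p + Dir.west.vec)) := by
    refine Finset.sum_eq_single_of_mem _ (Finset.mem_univ _) fun d _ hd => ?_
    rw [assembly_eq_none hl fun h => ?_, Tile.touch]
    have := h.1.2
    cases d <;> simp [Dir.vec] at this hd <;> lia
  rw [hbinding]
  by_cases hc : p = M.corner (c :: l)
  · subst hc
    rw [touch_west_corner hl hj ht]
    split_ifs with h <;> simp [h]
  · refine iff_of_false (Nat.lt_succ_iff.2 ?_).not_ge fun h => hc h.1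
    by_cases hx : p.1 = M.width (c :: l)
    · have hy : p.2 ≠ 0 := fun h => hc (Prod.ext hx h)
      rcases touch_west_eq_zero_or (j := j) (t := t) hl hx hy with h | h
      · exact h.le.trans zero_le_one
      · exact touch_le_left.trans (by rw [h]; rfl)
    · rw [assembly_eq_none hl fun h => hx (le_antisymm ?_ hp)]
      · exact zero_le_one
      · simpa [Dir.vec, Int.sub_one_lt_iff] using h.1.2

/-- The attachments inside a block: `M.Grow l p j t l'` says that the tile number `t` of the block
with label `j` attaches at the position `p` to the assembly of `l` and leads to that of `l'`. -/
inductive Grow (M : Counter) : List ℕ → ℤ × ℤ → ℕ → ℕ → List ℕ → Prop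
  | head {c : ℕ} {l : List ℕ} {m : ((ℤ × ℤ) × ℕ) × ℕ}
    (hm : m ∈ ((M.block (M.label l)).state c).moves) :
    Grow M (c :: l) (m.1.1 + M.corner l) (M.label l) m.1.2 (m.2 :: l)
  | tail {c j t : ℕ} {l l' : List ℕ} {p : ℤ × ℤ} (h : Grow M l p j t l') :
    Grow M (c :: l) p j t (c :: l')

namespace Grow

theorem ne_nil (h : M.Grow l p j t l') : l' ≠ [] := by
  cases h <;> exact List.cons_ne_nil _ _

theorem label_eq (h : M.Grow l p j t l') (hl : M.Valid l) (h0 : 0 < M.label l) :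
    M.label l' = M.label l := by
  induction h with
  | head hm => rw [label, label, (M.isGrowth _).exit_move _ (state_mem hl) _ hm (exit_ne_none h0)]
  | tail _ ih => rw [label, label, ih hl.1 hl.2.1]

theorem width_eq (h : M.Grow l p j t l') (hl : M.Valid l) : M.width l' = M.width l := by
  induction h with
  | head => rfl
  | tail h ih => rw [width, width, ih hl.1, h.label_eq hl.1 hl.2.1]

theorem valid (h : M.Grow l p j t l') (hl : M.Valid l) : M.Valid l' := by
  induction h with
  | head hm => exact ⟨hl.1, hl.2.1, ((M.isGrowth _).move _ (state_mem hl) _ hm).2.2.2⟩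
  | tail h ih => exact ⟨ih hl.1, by rw [h.label_eq hl.1 hl.2.1]; exact hl.2⟩

theorem mem_box (h : M.Grow l p j t l') (hl : M.Valid l) :
    p ∈ Set.Ico (0 : ℤ) (M.width l) ×ˢ Set.Ico (0 : ℤ) 4 := by
  induction h with
  | @head c l m hm =>
    have hbox := ((M.isGrowth _).move _ (state_mem hl) _ hm).1
    rw [← add_sub_cancel_right m.1.1 (M.corner l), sub_corner_mem_box (c := c)] at hbox
    exact ⟨⟨by lia, hbox.1.2⟩, by simpa using hbox.2⟩
  | tail _ ih =>
    obtain ⟨⟨h₁, h₂⟩, h₃⟩ := ih hl.1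
    exact ⟨⟨h₁, h₂.trans_le (mod_cast width_le_of_suffix (List.suffix_cons _ _))⟩, h₃⟩

theorem lt_length (h : M.Grow l p j t l') (hl : M.Valid l) : t < (M.block j).tiles.length := by
  induction h with
  | head hm => exact ((M.isGrowth _).move _ (state_mem hl) _ hm).2.2.1
  | tail _ ih => exact ih hl.1

theorem label_mem (h : M.Grow l p j t l') (hl : M.Valid l) : j ∈ Finset.Icc 1 (M.top + 1) := by
  induction h with
  | head => exact Finset.mem_Icc.2 ⟨hl.2.1, M.label_le _⟩
  | tail _ ih => exact ih hl.1

theorem assembly_eq_none (h : M.Grow l p j t l') (hl : M.Valid l) : M.assembly l p = none := by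
  induction h with
  | @head c l m hm =>
    obtain ⟨hbox, hlook, -⟩ := (M.isGrowth _).move _ (state_mem hl) _ hm
    rw [← add_sub_cancel_right m.1.1 (M.corner l), sub_corner_mem_box (c := c)] at hbox
    rw [assembly_cons_of_le hbox.1.1, add_sub_cancel_right, hlook]
    rfl
  | tail h ih => rw [assembly_cons_of_lt (h.mem_box hl.1).1.2, ih hl.1]

theorem assembly_eq (h : M.Grow l p j t l') (hl : M.Valid l) :
    M.assembly l' = (M.assembly l).add p (M.tile j t) := by
  induction h with
  | @head c l m hm =>
    obtain ⟨hbox, -⟩ := (M.isGrowth _).move _ (state_mem hl) _ hm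
    have hp := (sub_corner_mem_box (c := c)).1 (by rwa [add_sub_cancel_right m.1.1 (M.corner l)])
    funext q
    rw [Assembly.add, Function.update_apply]
    rcases lt_or_ge q.1 (M.width l : ℤ) with hq | hq
    · rw [if_neg (by rintro rfl; exact hp.1.1.not_gt hq), assembly_cons_of_lt hq,
        assembly_cons_of_lt hq]
    · rw [assembly_cons_of_le hq, assembly_cons_of_le hq]
      by_cases hq' : q - M.corner l ∈ (M.block (M.label l)).box
      · rw [(M.isGrowth _).look_move _ (state_mem hl) _ hm _ hq']
        simp only [sub_eq_iff_eq_add]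
        split_ifs <;> rfl
      · rw [look_eq_none hl hq', look_eq_none (Grow.head hm |>.valid hl) hq', if_neg]
        rintro rfl
        exact hq' (by rwa [add_sub_cancel_right])
  | tail h ih =>
    funext q
    rw [Assembly.add, Function.update_apply]
    rcases lt_or_ge q.1 (M.width _ : ℤ) with hq | hq
    · rw [assembly_cons_of_lt hq, assembly_cons_of_lt (by rwa [← h.width_eq hl.1]), ih hl.1,
        Assembly.add, Function.update_apply]
    · rw [assembly_cons_of_le hq, corner, h.width_eq hl.1, h.label_eq hl.1 hl.2.1, if_neg]
      · rw [assembly_cons_of_le (by rwa [← h.width_eq hl.1])]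
        rfl
      · rintro rfl
        exact hq.not_gt (by rw [h.width_eq hl.1]; exact (h.mem_box hl.1).1.2)

end Grow

theorem exists_grow_cons_iff_of_lt (hl : M.Valid (c :: l)) (hp : p.1 < M.width l) :
    (∃ l', M.Grow (c :: l) p j t l') ↔ ∃ l', M.Grow l p j t l' := by
  refine ⟨?_, fun ⟨_, h⟩ => ⟨_, h.tail⟩⟩
  rintro ⟨_, @⟨_, _, m, hm⟩ | h⟩
  · have hbox := ((M.isGrowth _).move _ (state_mem hl) _ hm).1
    rw [← add_sub_cancel_right m.1.1 (M.corner l), sub_corner_mem_box (c := c)] at hbox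
    exact absurd hbox.1.1 hp.not_ge
  · exact ⟨_, h⟩

theorem exists_grow_cons_iff_of_le (hl : M.Valid (c :: l)) (hp : M.width l ≤ p.1) :
    (∃ l', M.Grow (c :: l) p j t l') ↔ j = M.label l ∧
      (p - M.corner l, t) ∈ ((M.block (M.label l)).state c).moves.map Prod.fst := by
  constructor
  · rintro ⟨_, hm | h⟩
    · exact ⟨rfl, List.mem_map.2 ⟨_, hm, by rw [add_sub_cancel_right]⟩⟩
    · exact absurd (h.mem_box hl.1).1.2 hp.not_gt
  · rintro ⟨rfl, h⟩
    obtain ⟨m, hm, hmp⟩ := List.mem_map.1 h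
    have := Grow.head (M := M) hm
    rw [hmp, sub_add_cancel] at this
    exact ⟨_, this⟩

theorem two_le_binding_iff_exists_grow (hl : M.Valid l)
    (hp : p ∈ Set.Ico (0 : ℤ) (M.width l) ×ˢ Set.Ico (0 : ℤ) 4) (hnone : M.assembly l p = none)
    (ht : t < (M.block j).tiles.length) :
    2 ≤ (M.assembly l).binding Glue.strength p (M.tile j t) ↔ ∃ l', M.Grow l p j t l' := by
  induction l with
  | nil => exact absurd hp.1.2 hp.1.1.not_gt
  | cons c l ih =>
    rcases lt_or_ge p.1 (M.width l : ℤ) with hx | hx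
    · rw [assembly_cons_of_lt hx] at hnone
      rw [binding_assembly_cons_of_lt hl hp.1.1 hx hnone, ih hl.1 ⟨⟨hp.1.1, hx⟩, hp.2⟩ hnone,
        exists_grow_cons_iff_of_lt hl hx]
    · have hbox := (sub_corner_mem_box (c := c)).2 ⟨⟨hx, hp.1.2⟩, by simpa using hp.2⟩
      rw [two_le_binding_iff_of_mem_box hl hbox hnone ht, exists_grow_cons_iff_of_le hl hx]

theorem two_le_binding_iff (hl : M.Valid (c :: l)) (hnone : M.assembly (c :: l) p = none)
    (hj : j ∈ Finset.Icc 1 (M.top + 1)) (ht : t < (M.block j).tiles.length) :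
    2 ≤ (M.assembly (c :: l)).binding Glue.strength p (M.tile j t) ↔
      (∃ l', M.Grow (c :: l) p j t l') ∨ p = M.corner (c :: l) ∧ j = M.label (c :: l) ∧ t = 0 := by
  rw [Finset.mem_Icc] at hj
  by_cases hp : p ∈ Set.Ico (0 : ℤ) (M.width (c :: l)) ×ˢ Set.Ico (0 : ℤ) 4
  · rw [two_le_binding_iff_exists_grow hl hp hnone ht, or_iff_left]
    rintro ⟨rfl, -⟩
    exact hp.1.2.false
  rw [or_iff_right fun ⟨_, h⟩ => hp (h.mem_box hl)]
  rcases le_or_gt (M.width (c :: l) : ℤ) p.1 with hx | hx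
  · exact two_le_binding_iff_of_width_le hl hx hj.1 ht
  refine iff_of_false (not_le.2 ?_) fun h => hx.ne (by rw [h.1, corner])
  rcases lt_or_ge p.1 0 with hx' | hx'
  · rw [binding_eq_zero_of_fst_neg hl hx' hj.2 ht]
    exact two_pos
  · exact (binding_le_one_of_snd_notMem hl (fun h => hp ⟨⟨hx', hx⟩, h⟩) _).trans_lt one_lt_two

theorem assembly_zero_cons (hl : M.Valid l) :
    M.assembly (0 :: l) = (M.assembly l).add (M.corner l) (M.tile (M.label l) 0) := by
  funext p
  rw [Assembly.add, Function.update_apply]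
  rcases lt_or_ge p.1 (M.width l : ℤ) with hp | hp
  · rw [assembly_cons_of_lt hp, if_neg (by rintro rfl; exact hp.false)]
  · rw [assembly_cons_of_le hp, assembly_eq_none hl fun h => h.1.2.not_ge hp, BlockState.look,
      (M.isGrowth _).start.2]
    by_cases h : p = M.corner l
    · rw [h, sub_self, if_pos rfl]
      rfl
    · have hne : (p - M.corner l == ((0, 0) : ℤ × ℤ)) = false := beq_false_of_ne (sub_ne_zero.2 h)
      rw [if_neg h, List.lookup_cons, hne]
      rfl

theorem Valid.of_suffix (hl : M.Valid l) (h : l' <:+ l) : M.Valid l' := by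
  obtain ⟨l'', rfl⟩ := h
  induction l'' with
  | nil => exact hl
  | cons c l'' ih => exact ih hl.1

theorem eq_of_assembly_cons_eq (hl : M.Valid (c :: l)) (hl' : M.Valid (i :: l))
    (h : ∀ p : ℤ × ℤ, p.1 < M.width (c :: l) → M.assembly (c :: l) p = M.assembly (i :: l) p) :
    c = i := by
  refine (M.isGrowth (M.label l)).state_injective c hl.2.2 i hl'.2.2 fun q hq => ?_
  have hq' := (sub_corner_mem_box (c := c) (p := q + M.corner l)).1 (by rwa [add_sub_cancel_right])
  have hlook := h _ hq'.1.2
  rw [assembly_cons_of_le hq'.1.1, assembly_cons_of_le hq'.1.1, add_sub_cancel_right] at hlook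
  cases hu : ((M.block (M.label l)).state c).look q with
  | none => simpa [hu, eq_comm] using hlook
  | some u =>
    rw [hu, Option.map_some, eq_comm, Option.map_eq_some_iff] at hlook
    obtain ⟨u', hu', htile⟩ := hlook
    rw [hu', M.tile_injOn _ (wellPlaced_of_look hl' hu').lt_length
      (wellPlaced_of_look hl hu).lt_length htile]

theorem isSuffix_of_assembly_eq (hl : M.Valid l) (hl' : M.Valid l')
    (h : ∀ p : ℤ × ℤ, p.1 < M.width l → M.assembly l p = M.assembly l' p) : l <:+ l' := by
  induction l with
  | nil => exact List.nil_suffix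
  | cons c l ih =>
    have hwidth : (M.width l : ℤ) < M.width (c :: l) := by
      exact_mod_cast Nat.lt_add_of_pos_right (M.cols_pos _)
    obtain ⟨l₁, rfl⟩ := ih hl.1 fun p hp => by
      rw [← assembly_cons_of_lt hp, h p (hp.trans hwidth)]
    obtain rfl | ⟨l₂, i, rfl⟩ := List.eq_nil_or_concat l₁
    · refine absurd (h (M.width l, 0) hwidth) ?_
      rw [List.nil_append, assembly_eq_none hl.1 fun h => h.1.2.false]
      exact assembly_cons_row_ne_none hl le_rfl hwidth (.inl rfl)
    have happend : (l₂ ++ [i]) ++ l = l₂ ++ i :: l := List.append_cons .. |>.symm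
    rw [List.concat_eq_append, happend] at hl' h ⊢
    have hi : i :: l <:+ l₂ ++ i :: l := List.suffix_append ..
    rwa [eq_of_assembly_cons_eq hl (hl'.of_suffix hi) fun p hp => (h p hp).trans
      (assembly_append_of_lt (l := i :: l) hp l₂).1]

theorem assembly_injOn (M : Counter) : Set.InjOn M.assembly {l | M.Valid l} := by
  intro l hl l' hl' h
  have h₁ := isSuffix_of_assembly_eq hl hl' fun p _ => congrFun h p
  have h₂ := isSuffix_of_assembly_eq hl' hl fun p _ => congrFun h.symm p
  exact h₁.eq_of_length_le h₂.length_le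

theorem finite_dom_assembly (hl : M.Valid l) : (M.assembly l).dom.Finite :=
  ((Set.finite_Ico _ _).prod (Set.finite_Ico _ _)).subset (dom_assembly_subset hl)

theorem dom_assembly_singleton_zero (M : Counter) : (M.assembly [0]).dom = {(0, 0)} := by
  have hnil : (M.assembly []).dom = ∅ := Set.eq_empty_of_forall_notMem fun _ hp => hp rfl
  rw [assembly_zero_cons (show M.Valid [] from trivial), Assembly.dom_add, hnil]
  exact insert_empty_eq _

theorem Valid.zero_cons (hl : M.Valid l) (h0 : 0 < M.label l) : M.Valid (0 :: l) :=
  ⟨hl, h0, (M.isGrowth _).start.1⟩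

theorem valid_singleton_zero (M : Counter) : M.Valid [0] :=
  Valid.zero_cons (show M.Valid [] from trivial) (Nat.succ_pos _)

/-- The tile system of a counter: the seed is the first tile of the first block. -/
abbrev system (M : Counter) : TileSystem where
  Glue := Glue
  str := Glue.strength
  tiles := (Finset.Icc 1 (M.top + 1)).biUnion fun j =>
    (Finset.range (M.block j).tiles.length).image (M.tile j)
  seed := M.assembly [0]
  temp := 2
  temp_pos := two_pos
  seed_finite := finite_dom_assembly M.valid_singleton_zero
  seed_nonempty := by simp [dom_assembly_singleton_zero]
  seed_tiles p a ha := by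
    obtain ⟨c, l, u, hl, -, rfl, hu⟩ := exists_tile_of_assembly M.valid_singleton_zero ha
    exact Finset.mem_biUnion.2 ⟨M.label l, Finset.mem_Icc.2 ⟨hl.2.1, M.label_le l⟩,
      Finset.mem_image_of_mem _ (Finset.mem_range.2 hu.lt_length)⟩
  seed_stable S hS hdom := by
    rw [dom_assembly_singleton_zero, Set.ssubset_singleton_iff, Finset.coe_eq_empty] at hdom
    exact absurd hdom hS.ne_empty

theorem mem_tiles_system :
    a ∈ M.system.tiles ↔ ∃ j ∈ Finset.Icc 1 (M.top + 1), ∃ t < (M.block j).tiles.length,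
      M.tile j t = a := by
  simp only [system, Finset.mem_biUnion, Finset.mem_image, Finset.mem_range]

theorem mem_attachments_iff (hl : M.Valid (c :: l)) (hA : M.system.Producible (M.assembly (c :: l)))
    {a : (ℤ × ℤ) × Tile Glue} :
    a ∈ M.system.attachments (M.assembly (c :: l)) ↔
      (∃ j t l', M.Grow (c :: l) a.1 j t l' ∧ a.2 = M.tile j t) ∨
        0 < M.label (c :: l) ∧ a = (M.corner (c :: l), M.tile (M.label (c :: l)) 0) := by
  obtain ⟨p, b⟩ := a
  rw [hA.mem_attachments_iff, mem_tiles_system]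
  constructor
  · rintro ⟨⟨j, hj, t, ht, rfl⟩, hnone, hbind⟩
    rcases (two_le_binding_iff hl hnone hj ht).1 hbind with ⟨l', h⟩ | ⟨rfl, rfl, rfl⟩
    · exact .inl ⟨j, t, l', h, rfl⟩
    · exact .inr ⟨(Finset.mem_Icc.1 hj).1, rfl⟩
  · rintro (⟨j, t, l', h, rfl : b = _⟩ | ⟨h0, h⟩)
    · have hj := h.label_mem hl
      have ht := h.lt_length hl
      have hnone := h.assembly_eq_none hl
      exact ⟨⟨j, hj, t, ht, rfl⟩, hnone, (two_le_binding_iff hl hnone hj ht).2 (.inl ⟨l', h⟩)⟩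
    · obtain ⟨rfl, rfl⟩ := Prod.mk_inj.1 h
      have hj : M.label (c :: l) ∈ Finset.Icc 1 (M.top + 1) := Finset.mem_Icc.2 ⟨h0, M.label_le _⟩
      have ht : 0 < (M.block (M.label (c :: l))).tiles.length := M.length_tiles_pos _
      have hnone : M.assembly (c :: l) (M.corner (c :: l)) = none :=
        assembly_eq_none hl fun h => h.1.2.false
      exact ⟨⟨_, hj, 0, ht, rfl⟩, hnone,
        (two_le_binding_iff hl hnone hj ht).2 (.inr ⟨rfl, rfl, rfl⟩)⟩

theorem exists_valid_of_producible {A : Assembly Glue} (hA : M.system.Producible A) :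
    ∃ c l, M.Valid (c :: l) ∧ M.assembly (c :: l) = A := by
  refine hA.induction_on (p := fun A => ∃ c l, M.Valid (c :: l) ∧ M.assembly (c :: l) = A)
    ⟨0, [], M.valid_singleton_zero, rfl⟩ ?_
  rintro _ B hA ⟨c, l, hl, rfl⟩ h
  obtain ⟨a, ha, rfl⟩ := TileSystem.step_iff.1 h
  rcases (mem_attachments_iff hl hA).1 ha with ⟨j, t, l', h, hb⟩ | ⟨h0, rfl⟩
  · obtain ⟨i, l', rfl⟩ := List.exists_cons_of_ne_nil h.ne_nil
    exact ⟨i, l', h.valid hl, by rw [h.assembly_eq hl, hb]⟩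
  · exact ⟨0, c :: l, hl.zero_cons h0, assembly_zero_cons hl⟩

/-- The conditions under which `E i` is the expected number of columns that are built after a
counter value `i` has been reached. -/
structure ExpectedWidth (M : Counter) (E : ℕ → ℝ≥0) : Prop where
  zero : E 0 = 0
  le_top : ∀ i ≤ M.top, E i ≤ E M.top
  succ : ∀ i < M.top, ∀ w, (M.block (i + 1)).cols +
    (E i + (M.block (i + 1)).loopProb w 0 * (E M.top - E i)) = E (i + 1)

/-- The expected width of the finished line, given the states of the blocks that have been started,
if `E i` columns are expected after the counter value `i`. -/
def mean (M : Counter) (E : ℕ → ℝ≥0) (P : Tile Glue → ℝ≥0) : List ℕ → ℝ≥0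
  | [] => 0
  | c :: l => M.width (c :: l) + (E (M.label l - 1) +
    (M.block (M.label l)).loopProb (fun t => P (M.tile (M.label l) t)) c *
      (E M.top - E (M.label l - 1)))

variable {E : ℕ → ℝ≥0} {P : Tile Glue → ℝ≥0}

theorem width_le_mean (M : Counter) (E : ℕ → ℝ≥0) (P : Tile Glue → ℝ≥0) :
    ∀ l, M.width l ≤ M.mean E P l
  | [] => by simp [width]
  | _ :: _ => le_self_add

theorem mean_singleton_zero (P : Tile Glue → ℝ≥0) :
    M.mean E P [0] = (M.block (M.top + 1)).cols + E M.top := by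
  simp [mean, width, label]

namespace ExpectedWidth

theorem sub_one_le (h : M.ExpectedWidth E) (l : List ℕ) : E (M.label l - 1) ≤ E M.top :=
  h.le_top _ (Nat.sub_le_iff_le_add.2 (M.label_le l))

theorem mean_cons_le (h : M.ExpectedWidth E) (c : ℕ) (l : List ℕ) :
    M.mean E P (c :: l) ≤ M.width (c :: l) + E M.top := by
  rw [mean]
  gcongr
  calc _ ≤ E (M.label l - 1) + 1 * (E M.top - E (M.label l - 1)) := by
        gcongr
        exact (M.hasLoopProb _).le_one _ _
    _ = E M.top := by rw [one_mul, add_tsub_cancel_of_le (h.sub_one_le l)]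

theorem mean_of_exit_ne_none (h : M.ExpectedWidth E) (hl : M.Valid (c :: l))
    (hexit : ((M.block (M.label l)).state c).exit ≠ none) :
    M.mean E P (c :: l) = M.width (c :: l) + E (M.label (c :: l)) := by
  obtain ⟨r, hr⟩ := Option.ne_none_iff_exists'.1 hexit
  rw [mean, (M.hasLoopProb _).exit _ c hl.2.2 r hr, label, hr]
  cases r
  · simp [target]
  · simp [target, add_tsub_cancel_of_le (h.sub_one_le l)]

theorem mean_zero_cons (h : M.ExpectedWidth E) (hl : M.Valid (c :: l))
    (h0 : 0 < M.label (c :: l)) : M.mean E P (0 :: c :: l) = M.mean E P (c :: l) := by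
  have hsucc := h.succ (M.label (c :: l) - 1) (by have := M.label_cons_le c l; lia)
    fun t => P (M.tile (M.label (c :: l)) t)
  rw [Nat.sub_add_cancel h0] at hsucc
  rw [h.mean_of_exit_ne_none hl (exit_ne_none h0), ← hsucc, mean, width]
  push_cast
  ring

theorem mean_eq_width (h : M.ExpectedWidth E) (hl : M.Valid (c :: l))
    (hexit : ((M.block (M.label l)).state c).exit ≠ none) (h0 : M.label (c :: l) = 0) :
    M.mean E P (c :: l) = M.width (c :: l) := by
  rw [h.mean_of_exit_ne_none hl hexit, h0, h.zero, add_zero]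

end ExpectedWidth

theorem Grow.mean_tail (h : M.Grow l p j t l') (hl : M.Valid (c :: l)) :
    M.mean E P (c :: l') = M.mean E P (c :: l) := by
  rw [mean, mean, width, width, h.width_eq hl.1, h.label_eq hl.1 hl.2.1]

theorem sum_moves_mul_mean (hl : M.Valid (c :: l)) (hP : ∀ a ∈ M.system.tiles, 0 < P a) :
    (((M.block (M.label l)).state c).moves.map fun m =>
        P (M.tile (M.label l) m.1.2) * M.mean E P (m.2 :: l)).sum =
      (((M.block (M.label l)).state c).moves.map fun m => P (M.tile (M.label l) m.1.2)).sum *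
        M.mean E P (c :: l) := by
  have hpos (t) (ht : t < (M.block (M.label l)).tiles.length) : 0 < P (M.tile (M.label l) t) :=
    hP _ (mem_tiles_system.2 ⟨_, Finset.mem_Icc.2 ⟨hl.2.1, M.label_le l⟩, t, ht, rfl⟩)
  have hloop := (M.hasLoopProb _).harmonic _ hpos c hl.2.2
  have hmean (i : ℕ) : M.mean E P (i :: l) = (M.width (c :: l) + E (M.label l - 1)) +
      (E M.top - E (M.label l - 1)) *
        (M.block (M.label l)).loopProb (fun t => P (M.tile (M.label l) t)) i := by
    rw [mean, width, width]
    ring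
  simp only [hmean, mul_add, mul_left_comm _ (E M.top - _), List.sum_map_add,
    List.sum_map_mul_right, List.sum_map_mul_left, hloop]

/-- The function `mean` on the assemblies. -/
def meanOn (M : Counter) (E : ℕ → ℝ≥0) (P : Tile Glue → ℝ≥0) (A : Assembly Glue) : ℝ≥0 :=
  M.mean E P (Function.invFunOn M.assembly {l | M.Valid l} A)

theorem meanOn_assembly (hl : M.Valid l) : M.meanOn E P (M.assembly l) = M.mean E P l :=
  congrArg _ (M.assembly_injOn.leftInvOn_invFunOn hl)

theorem ExpectedWidth.harmonicAt (h : M.ExpectedWidth E) (hP : ∀ a ∈ M.system.tiles, 0 < P a)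
    (hl : M.Valid (c :: l)) (hA : M.system.Producible (M.assembly (c :: l))) :
    M.system.HarmonicAt P (fun A => M.meanOn E P A) (M.assembly (c :: l)) := by
  have hhead (m) (hm : m ∈ ((M.block (M.label l)).state c).moves) := Grow.head (M := M) hm
  have hmean (m) (hm : m ∈ ((M.block (M.label l)).state c).moves) :
      M.meanOn E P ((M.assembly (c :: l)).add (m.1.1 + M.corner l) (M.tile (M.label l) m.1.2)) =
        M.mean E P (m.2 :: l) := by
    rw [← (hhead m hm).assembly_eq hl, meanOn_assembly ((hhead m hm).valid hl)]
  refine hA.harmonicAt_of_list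
    (Y := (((M.block (M.label l)).state c).moves.map Prod.fst).map fun x =>
      (x.1 + M.corner l, M.tile (M.label l) x.2)) ?_ ?_ ?_ ?_
  · refine ((M.isGrowth _).nodup_moves _ (state_mem hl)).map_on ?_
    simp only [List.forall_mem_map]
    intro m hm m' hm' heq
    rw [Prod.mk_inj, add_left_inj] at heq
    exact Prod.ext heq.1 (M.tile_injOn _ ((hhead m hm).lt_length hl)
      ((hhead m' hm').lt_length hl) heq.2)
  · simp only [List.forall_mem_map]
    exact fun m hm => (mem_attachments_iff hl hA).2 (.inl ⟨_, _, _, hhead m hm, rfl⟩)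
  · rintro ⟨p, b⟩ ha hnot
    rcases (mem_attachments_iff hl hA).1 ha with ⟨j, t, l', hg, rfl : b = _⟩ | ⟨h0, heq⟩
    · rw [← hg.assembly_eq hl, meanOn_assembly (hg.valid hl), meanOn_assembly hl]
      cases hg with
      | head hm => exact absurd (List.mem_map_of_mem (List.mem_map_of_mem hm)) hnot
      | tail hg => exact hg.mean_tail hl
    · rw [heq, ← assembly_zero_cons hl, meanOn_assembly (hl.zero_cons h0),
        meanOn_assembly hl, h.mean_zero_cons hl h0]
  · simp only [List.map_map, Function.comp_def]
    rw [List.map_congr_left (fun m hm => by rw [hmean m hm]), sum_moves_mul_mean hl hP,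
      meanOn_assembly hl]

theorem ncard_box (n : ℕ) : (Set.Ico (0 : ℤ) n ×ˢ Set.Ico (0 : ℤ) 4).ncard = n * 4 := by
  rw [Set.ncard_prod]
  simp [Set.ncard_eq_toFinset_card']

theorem ncard_dom_assembly_le (hl : M.Valid l) : (M.assembly l).dom.ncard ≤ M.width l * 4 :=
  (Set.ncard_le_ncard (dom_assembly_subset hl)).trans (ncard_box _).le

theorem width_le_ncard_dom_assembly (hl : M.Valid (c :: l)) :
    M.width l ≤ (M.assembly (c :: l)).dom.ncard := by
  have hinj : Function.Injective fun x : ℤ => (x, (0 : ℤ)) := Prod.mk_left_injective 0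
  have hsub : (fun x : ℤ => (x, (0 : ℤ))) '' Set.Ico 0 (M.width l) ⊆ (M.assembly (c :: l)).dom := by
    rintro _ ⟨x, hx, rfl⟩
    exact (assembly_cons_of_lt hx.2).trans_ne (assembly_row_ne_none hl.1 hl.2.1 hx.1 hx.2)
  calc M.width l = (Set.Ico (0 : ℤ) (M.width l)).ncard := by simp [Set.ncard_eq_toFinset_card']
    _ = _ := (Set.ncard_image_of_injective _ hinj).symm
    _ ≤ _ := Set.ncard_le_ncard hsub (finite_dom_assembly hl)

theorem ExpectedWidth.isHarmonicSize (h : M.ExpectedWidth E)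
    (hP : ∀ a ∈ M.system.tiles, 0 < P a) : M.system.IsHarmonicSize P (M.meanOn E P) where
  harmonicAt A hA := by
    obtain ⟨c, l, hl, rfl⟩ := exists_valid_of_producible hA
    exact h.harmonicAt hP hl hA
  exists_ncard_le := by
    refine ⟨4, fun A hA => ?_⟩
    obtain ⟨c, l, hl, rfl⟩ := exists_valid_of_producible hA
    calc ((M.assembly (c :: l)).dom.ncard : ℝ≥0) ≤ (M.width (c :: l) * 4 : ℕ) :=
          mod_cast ncard_dom_assembly_le hl
      _ = 4 * M.width (c :: l) := by push_cast; ring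
      _ ≤ 4 * M.mean E P (c :: l) := by gcongr; exact M.width_le_mean ..
      _ = _ := by rw [meanOn_assembly hl]
  exists_le_ncard := by
    refine ⟨(∑ i ∈ Finset.range (M.top + 2), (M.block i).cols : ℕ) + E M.top, fun A hA => ?_⟩
    obtain ⟨c, l, hl, rfl⟩ := exists_valid_of_producible hA
    have hcols : (M.block (M.label l)).cols ≤ ∑ i ∈ Finset.range (M.top + 2), (M.block i).cols :=
      Finset.single_le_sum (f := fun i => (M.block i).cols) (fun _ _ => Nat.zero_le _)
        (Finset.mem_range.2 (Nat.lt_succ_of_le (M.label_le l)))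
    have hwidth := width_le_ncard_dom_assembly hl
    rw [meanOn_assembly hl, ← add_assoc]
    refine (h.mean_cons_le c l).trans (add_le_add_left ?_ _)
    exact_mod_cast add_le_add hwidth hcols

theorem dom_assembly_of_forall_not_grow (hl : M.Valid l)
    (h : ∀ p j t l', ¬ M.Grow l p j t l') :
    (M.assembly l).dom = Set.Ico (0 : ℤ) (M.width l) ×ˢ Set.Ico (0 : ℤ) 4 := by
  refine (dom_assembly_subset hl).antisymm fun p hp => ?_
  induction l with
  | nil => exact absurd hp.1.2 hp.1.1.not_gt
  | cons c l ih =>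
    rcases lt_or_ge p.1 (M.width l : ℤ) with hx | hx
    · exact (assembly_cons_of_lt hx).trans_ne
        (ih hl.1 (fun p j t l' hg => h p j t _ hg.tail) ⟨⟨hp.1.1, hx⟩, hp.2⟩)
    · have hbox := (sub_corner_mem_box (c := c)).2 ⟨⟨hx, hp.1.2⟩, by simpa using hp.2⟩
      have hmoves : ((M.block (M.label l)).state c).moves = [] :=
        List.eq_nil_iff_forall_not_mem.2 fun m hm => h _ _ _ _ (.head hm)
      have hfull := ((M.isGrowth _).full _ (state_mem hl) hmoves).2 _ hbox
      refine (assembly_cons_of_le hx).trans_ne ?_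
      rwa [ne_eq, Option.map_eq_none_iff, ← ne_eq, Option.ne_none_iff_isSome]

theorem terminal_spec (h : M.ExpectedWidth E) {A : Assembly Glue} (hA : M.system.Terminal A) :
    ∃ n : ℕ, M.meanOn E P A = n ∧ A.dom = Set.Ico (0 : ℤ) n ×ˢ Set.Ico (0 : ℤ) 4 := by
  obtain ⟨c, l, hl, rfl⟩ := exists_valid_of_producible hA.1
  have hnot (a) (ha : a ∈ M.system.attachments (M.assembly (c :: l))) : False :=
    hA.2 _ (TileSystem.step_iff.2 ⟨a, ha, rfl⟩)
  have hgrow (p j t l') (hg : M.Grow (c :: l) p j t l') : False :=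
    hnot (p, M.tile j t) ((mem_attachments_iff hl hA.1).2 (.inl ⟨j, t, l', hg, rfl⟩))
  have hlabel : M.label (c :: l) = 0 := Nat.eq_zero_of_not_pos fun h0 =>
    hnot _ ((mem_attachments_iff hl hA.1).2 (.inr ⟨h0, rfl⟩))
  have hmoves : ((M.block (M.label l)).state c).moves = [] :=
    List.eq_nil_iff_forall_not_mem.2 fun m hm => hgrow _ _ _ _ (.head hm)
  have hexit := ((M.isGrowth _).full _ (state_mem hl) hmoves).1
  exact ⟨M.width (c :: l), by rw [meanOn_assembly hl, h.mean_eq_width hl hexit hlabel],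
    dom_assembly_of_forall_not_grow hl hgrow⟩

theorem length_eq_of_dom_eq {A : Assembly Glue} {n : ℕ}
    (h : A.dom = Set.Ico (0 : ℤ) n ×ˢ Set.Ico (0 : ℤ) 4) : A.length = n := by
  rw [Assembly.length, h, Set.fst_image_prod _ (Set.nonempty_Ico.2 (by norm_num))]
  simp [Set.ncard_eq_toFinset_card']

theorem ExpectedWidth.expectedLength_eq (h : M.ExpectedWidth E)
    (hP : ∀ a ∈ M.system.tiles, 0 < P a) :
    M.system.expectedLength P = ((M.block (M.top + 1)).cols + E M.top : ℝ≥0) := by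
  have hterm (A : {A // M.system.Terminal A}) :
      (A.1.length : ℝ≥0∞) * M.system.probTerm P A = M.meanOn E P A * M.system.probTerm P A := by
    obtain ⟨n, hmean, hdom⟩ := terminal_spec (P := P) h A.2
    rw [length_eq_of_dom_eq hdom, hmean, ENNReal.coe_natCast]
  rw [TileSystem.expectedLength, tsum_congr hterm, (h.isHarmonicSize hP).tsum_terminal_eq hP]
  exact congrArg _ ((meanOn_assembly M.valid_singleton_zero).trans (mean_singleton_zero P))

/-- The counter with `w.length` nonzero values below its start, in which the value `i + 1` is
represented by a coin if `w[i] = true` and by a single column if `w[i] = false`. -/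
def ofList (w : List Bool) : Counter where
  top := w.length
  block i := if w.getD (i - 1) false then Block.coin else Block.column
  isGrowth i := by
    split_ifs
    exacts [Block.isGrowth_coin, Block.isGrowth_column]
  hasLoopProb i := by
    split_ifs
    exacts [Block.hasLoopProb_coin, Block.hasLoopProb_column]

/-- The number `gap (w.drop i)` is the difference between the expected numbers of columns that are
built after the values `w.length` and `i` of the counter `ofList w`. -/
def gap : List Bool → ℕ
  | [] => 0
  | true :: w => 2 * gap w + 10
  | false :: w => gap w + 1

theorem gap_drop_le (w : List Bool) : ∀ i, gap (w.drop i) ≤ gap w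
  | 0 => le_rfl
  | i + 1 => by
    cases w with
    | nil => exact le_rfl
    | cons b w =>
      refine (gap_drop_le w i).trans ?_
      cases b <;> simp only [gap] <;> lia

theorem expectedWidth_ofList (w : List Bool) :
    (ofList w).ExpectedWidth fun i => gap w - gap (w.drop i) where
  zero := tsub_self _
  le_top i _ := by simp [ofList, gap]
  succ i hi v := by
    have hi : i < w.length := hi
    have hle (j) : (gap (w.drop j) : ℝ≥0) ≤ gap w := mod_cast gap_drop_le w j
    have htop : (gap w : ℝ≥0) - gap (w.drop (ofList w).top) = gap w := by simp [ofList, gap]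
    have hdrop : w.drop i = w[i] :: w.drop (i + 1) := List.drop_eq_getElem_cons hi
    have hblock : (ofList w).block (i + 1) = if w[i] then Block.coin else Block.column := by
      simp [ofList, hi]
    rw [htop, tsub_tsub_cancel_of_le (hle i)]
    refine eq_tsub_of_add_eq ?_
    rw [← tsub_add_cancel_of_le (hle i), add_tsub_cancel_right, hblock, hdrop]
    cases w[i]
    · simp [Block.column, gap]
      ring
    · simp [Block.coin, gap]
      field_simp
      ring

theorem expectedLength_ofList (w : List Bool) {P : Tile Glue → ℝ≥0}
    (hP : ∀ a ∈ (ofList w).system.tiles, 0 < P a) :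
    (ofList w).system.expectedLength P = (gap w + 1 : ℕ) := by
  rw [(expectedWidth_ofList w).expectedLength_eq hP]
  simp [ofList, gap, Block.column, add_comm]

theorem card_tiles_ofList_le (w : List Bool) :
    (ofList w).system.tiles.card ≤ 20 * (w.length + 1) := by
  have hblock (i) : ((ofList w).block i).tiles.length ≤ 20 := by
    simp only [ofList]
    split_ifs <;> decide
  calc _ ≤ ∑ _j ∈ Finset.Icc 1 (w.length + 1), 20 :=
        Finset.card_biUnion_le.trans <| Finset.sum_le_sum fun _ _ =>
          Finset.card_image_le.trans <| (Finset.card_range _).trans_le (hblock _)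
    _ = 20 * (w.length + 1) := by simp [mul_comm]

theorem gap_replicate_false (n : ℕ) : gap (List.replicate n false) = n := by
  induction n with
  | zero => rfl
  | succ n ih => rw [List.replicate_succ, gap, ih]

theorem exists_gap_eq (g : ℕ) :
    ∃ w : List Bool, gap w = g ∧ w.length ≤ 2 * Nat.log 2 (g + 1) + 9 := by
  induction g using Nat.strong_induction_on with
  | _ g ih =>
    by_cases hg : g < 10
    · exact ⟨List.replicate g false, gap_replicate_false g, by simp; lia⟩
    obtain ⟨r, hr⟩ := Nat.even_or_odd' g
    obtain ⟨w, hw, hlen⟩ := ih (r - 5) (by lia)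
    have hlog : Nat.log 2 (r - 5 + 1) + 1 ≤ Nat.log 2 (g + 1) := by
      rw [← Nat.log_mul_base one_lt_two (Nat.succ_ne_zero _)]
      exact Nat.log_mono_right (by lia)
    rcases hr with rfl | rfl
    · exact ⟨true :: w, by rw [gap]; lia, by rw [List.length_cons]; lia⟩
    · exact ⟨false :: true :: w, by rw [gap, gap]; lia, by simp only [List.length_cons]; lia⟩

end Counter

theorem isBigO_log_of_le_natLog {f : ℕ → ℕ} (C : ℕ) (h : ∀ n, 2 ≤ n → f n ≤ C * Nat.log 2 n) :
    (fun n => (f n : ℝ)) =O[atTop] fun n : ℕ => Real.log n := by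
  refine IsBigO.of_bound (C / Real.log 2) ?_
  filter_upwards [eventually_ge_atTop 2] with n hn
  rw [Real.norm_of_nonneg (Nat.cast_nonneg _), Real.norm_of_nonneg (Real.log_natCast_nonneg n)]
  calc (f n : ℝ) ≤ C * (Nat.log 2 n : ℝ) := mod_cast h n hn
    _ ≤ C * Real.logb (2 : ℕ) n := by gcongr; exact Real.natLog_le_logb n 2
    _ = C / Real.log 2 * Real.log n := by rw [Real.logb, Nat.cast_ofNat]; ring

end ATAM

end

theorem mainTheorem4 :
    ∃ Γ : ℕ → ATAM.TileSystem,
      (fun n : ℕ => ((Γ n).tiles.card : ℝ)) =O[atTop] (fun n : ℕ => Real.log (n : ℝ)) ∧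
      ∀ n : ℕ, 0 < n →
        (Γ n).temp = 2 ∧
        (Γ n).seed.dom.ncard = 1 ∧
        (Γ n).IsFinite ∧
        (∀ A, (Γ n).Terminal A → ∃ l : ℕ, A.IsLine 4 l) ∧
        ∀ P : ATAM.Tile (Γ n).Glue → NNReal, (Γ n).IsConcentration P →
          (Γ n).totalProb P = 1 ∧ (Γ n).expectedLength P = (n : ENNReal) := by
  choose w hgap hlength using ATAM.Counter.exists_gap_eq
  refine ⟨fun n => (ATAM.Counter.ofList (w (n - 1))).system, ?_, fun n hn => ?_⟩
  · refine ATAM.isBigO_log_of_le_natLog 240 fun n hn => ?_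
    have hcard := ATAM.Counter.card_tiles_ofList_le (w (n - 1))
    have hlen := hlength (n - 1)
    have hlog : 0 < Nat.log 2 n := Nat.log_pos one_lt_two hn
    rw [Nat.sub_add_cancel (by lia)] at hlen
    lia
  · have hE := ATAM.Counter.expectedWidth_ofList (w (n - 1))
    refine ⟨rfl, ?_, ?_, fun A hA => ?_, fun P hP => ⟨?_, ?_⟩⟩
    · exact (congrArg Set.ncard (ATAM.Counter.dom_assembly_singleton_zero _)).trans
        (Set.ncard_singleton _)
    · exact (hE.isHarmonicSize (P := 1) fun _ _ => one_pos).isFinite fun _ _ => one_pos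
    · obtain ⟨l, -, hdom⟩ := ATAM.Counter.terminal_spec (P := 1) hE hA
      exact ⟨l, 0, 0, by simpa using hdom⟩
    · exact (hE.isHarmonicSize hP.1).totalProb_eq_one hP.1
    · rw [ATAM.Counter.expectedLength_ofList _ hP.1, hgap, Nat.sub_add_cancel hn]
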